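/- Let $\mathcal A_0=\bigoplus_{\alpha\in I}M_{n_\alpha}(\mathbb C)$ (algebraic direct sum, $n_\alpha\ge 1$, $I$ any index set) be a discrete quantum group: write $\mathcal M(\mathcal A_0)$, $\mathcal M(\mathcal A_0\otimes\mathcal A_0)$ for the C*-algebras of bounded families in $\prod_\alpha M_{n_\alpha}$, $\prod_{\alpha,\beta}M_{n_\alpha}\otimes M_{n_\beta}$; there is given a unital $*$-homomorphism $\Delta:\mathcal M(\mathcal A_0)\to\mathcal M(\mathcal A_0\otimes\mathcal A_0)$ such that $T_1(a\otimes b)=\Delta(a)(1\otimes b)$ and $T_2(a\otimes b)=(a\otimes 1)\Delta(b)$ define linear bijections of the algebraic tensor product $\mathcal A_0\otimes\mathcal A_0$ onto itself, and $(a\otimes1\otimes1)(\Delta\otimes \mathrm{id})(\Delta(b)(1\otimes c))=(\mathrm{id}\otimes\Delta)((a\otimes1)\Delta(b))(1\otimes1\otimes c)$ for $a,b,c\in\mathcal A_0$. Let $\epsilon$ and $S:\mathcal A_0\to\mathcal A_0$ be its counit and antipode. Let $\phi$ be a positive faithful left invariant linear functional on $\mathcal A_0$, i.e. $(\mathrm{id}\otimes\phi)((b\otimes1)\Delta(a))=\phi(a)b$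 for all $a,b\in\mathcal A_0$. Let $\theta=(\theta_\alpha)$ be the positive square root of the modular element of $\phi$, i.e. each $\theta_\alpha\in M_{n_\alpha}$ is positive definite and $\phi(S(a))=\phi(a\theta^2)$ for $a\in\mathcal A_0$; let $\psi(a)=\phi(a\theta^2)$ be the corresponding right Haar functional. Let $\mathcal A_0'$ be the space of linear functionals on $\mathcal A_0$ vanishing on all but finitely many $M_{n_\alpha}$; for $f,g\in\mathcal A_0'$ put $(f*g)(x)=(f\otimes g)(\Delta(x))$ and $f^*(x)=\overline{f(S(x)^*)}$, $x\in\mathcal A_0$. For $a\in\mathcal A_0$ let $\psi_a\in\mathcal A_0'$ be $\psi_a(x)=\psi(ax)$. Then for all $a,b\in\mathcal A_0$: (1) $(\mathrm{id}\otimes\psi)\big((1\otimes b)\,(\mathrm{id}\otimes S^{-1})(\Delta(a))\big)=(\phi\otimes\mathrm{id})\big((a\otimes1)\,(S\otimes\mathrm{id})(\Delta(b))\big)$; denote this element of $\mathcal A_0$ by $a*b$; (2) $\psi_a*\psi_b=\psi_{a*b}$; (3) $\psi_a^*=\psi_{a^\sharp}$, where $a^\sharp=\theta^{-2}S^{-1}(a^*)$.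 Moreover $a\mapsto\psi_a$ is injective, and the vector space $\mathcal A_0$ with the product $(a,b)\mapsto a*b$ and the involution $a\mapsto a^\sharp$ is an associative $*$-algebra $\hat{\mathcal A}_0$: $*$ is bilinear and associative, $\sharp$ is conjugate-linear, $(a*b)^\sharp=b^\sharp*a^\sharp$ and $(a^\sharp)^\sharp=a$. -/

import Mathlib

open scoped TensorProduct ComplexOrder

noncomputable section

namespace DQG

universe u

/-- Algebraic multipliers of `⊕ M_{n α}`: arbitrary families of matrices, with the
componentwise `*`-algebra structure. -/
abbrev Malg {I : Type u} (n : I → ℕ) : Type u :=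
  (α : I) → Matrix (Fin (n α)) (Fin (n α)) ℂ

/-- Algebraic multipliers of the tensor square: arbitrary families with `(α, β)` component in
`M_{n α} ⊗ M_{n β}`, realised as matrices over `Fin (n α) × Fin (n β)` (Kronecker products). -/
abbrev Malg₂ {I : Type u} (n : I → ℕ) : Type u :=
  (p : I × I) → Matrix (Fin (n p.1) × Fin (n p.2)) (Fin (n p.1) × Fin (n p.2)) ℂ

section Bounded

open scoped Matrix.Norms.L2Operator

/-- The bounded families of matrices, for the C*-norm (operator norm) on each block. -/
def boundedFamilies {J : Type u} (κ : J → Type) [∀ j, Fintype (κ j)] [∀ j, DecidableEq (κ j)] :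
    StarSubalgebra ℂ ((j : J) → Matrix (κ j) (κ j) ℂ) where
  carrier := {a | ∃ C : ℝ, ∀ j, ‖a j‖ ≤ C}
  mul_mem' := by
    rintro a b ⟨C, hC⟩ ⟨D, hD⟩
    refine ⟨C * D, fun j => (norm_mul_le (a j) (b j)).trans ?_⟩
    exact mul_le_mul (hC j) (hD j) (norm_nonneg _) ((norm_nonneg _).trans (hC j))
  add_mem' := by
    rintro a b ⟨C, hC⟩ ⟨D, hD⟩
    exact ⟨C + D, fun j => (norm_add_le (a j) (b j)).trans (add_le_add (hC j) (hD j))⟩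
  algebraMap_mem' := by
    intro r
    refine ⟨‖r‖, fun j => ?_⟩
    have h1 : ‖(1 : Matrix (κ j) (κ j) ℂ)‖ ≤ 1 := by
      have h := CStarRing.norm_star_mul_self (x := (1 : Matrix (κ j) (κ j) ℂ))
      rw [star_one, one_mul] at h
      nlinarith [norm_nonneg (1 : Matrix (κ j) (κ j) ℂ)]
    have h2 : (algebraMap ℂ ((j : J) → Matrix (κ j) (κ j) ℂ) r) j
        = r • (1 : Matrix (κ j) (κ j) ℂ) := by
      rw [Pi.algebraMap_apply, Algebra.algebraMap_eq_smul_one]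
    rw [h2, norm_smul]
    exact mul_le_of_le_one_right (norm_nonneg r) h1
  star_mem' := by
    rintro a ⟨C, hC⟩
    exact ⟨C, fun j => by rw [Pi.star_apply, norm_star]; exact hC j⟩

end Bounded

variable {I : Type u} {n : I → ℕ}

/-- The unital C*-algebra `M(A₀)` of bounded families `(a_α)`. -/
abbrev Mbdd (n : I → ℕ) : StarSubalgebra ℂ (Malg n) :=
  boundedFamilies (fun α => Fin (n α))

/-- The unital C*-algebra `M(A₀ ⊗ A₀)` of bounded families `(m_{αβ})`. -/
abbrev Mbdd₂ (n : I → ℕ) : StarSubalgebra ℂ (Malg₂ n) :=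
  boundedFamilies (fun p : I × I => Fin (n p.1) × Fin (n p.2))

/-- `A₀`, the algebraic direct sum of the matrix algebras `M_{n α}`, as the `*`-algebra of
finitely supported families. -/
def A₀ (n : I → ℕ) : NonUnitalStarSubalgebra ℂ (Malg n) where
  carrier := {a | {α | a α ≠ 0}.Finite}
  add_mem' := by
    intro a b ha hb
    refine (ha.union hb).subset fun α h => ?_
    by_contra h'
    simp only [Set.mem_union, Set.mem_ofPred_eq, not_or, not_not] at h'
    exact h (by simp [h'.1, h'.2])
  zero_mem' := by simp
  mul_mem' := by
    intro a b ha hb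
    refine ha.subset fun α h h' => h ?_
    simp [h']
  smul_mem' := by
    intro c a ha
    refine ha.subset fun α h h' => h ?_
    simp [h']
  star_mem' := by
    intro a ha
    refine ha.subset fun α h h' => h ?_
    simp [h']

theorem A₀_le_Mbdd (a : A₀ n) : (a : Malg n) ∈ Mbdd n := by
  classical
  have hfin : {α | (a : Malg n) α ≠ 0}.Finite := a.2
  let _ : ∀ α : I, NormedAddCommGroup (Matrix (Fin (n α)) (Fin (n α)) ℂ) :=
    fun _ => Matrix.instL2OpNormedAddCommGroup
  refine ⟨∑ α ∈ hfin.toFinset, ‖(a : Malg n) α‖, fun α => ?_⟩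
  by_cases h : (a : Malg n) α = 0
  · rw [h]
    exact (norm_zero (E := Matrix (Fin (n α)) (Fin (n α)) ℂ)).le.trans
      (Finset.sum_nonneg fun β _ => norm_nonneg ((a : Malg n) β))
  · exact Finset.single_le_sum (f := fun β => ‖(a : Malg n) β‖)
      (fun β _ => norm_nonneg ((a : Malg n) β)) (hfin.mem_toFinset.2 h)

/-- The inclusion of `A₀` in `M(A₀)`. -/
def toMbdd (a : A₀ n) : Mbdd n := ⟨a, A₀_le_Mbdd a⟩

open Classical in
/-- `M_{n α}` as a summand of `A₀`. -/
def single (α : I) (M : Matrix (Fin (n α)) (Fin (n α)) ℂ) : A₀ n :=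
  ⟨Pi.single α M, by
    refine (Set.finite_singleton α).subset fun β h => ?_
    by_contra h'
    exact h (Pi.single_eq_of_ne (M := fun γ => Matrix (Fin (n γ)) (Fin (n γ)) ℂ) h' M)⟩

/-- The matrix unit `e^α_{ij}`. -/
def matrixUnit (n : I → ℕ) (α : I) (i j : Fin (n α)) : A₀ n :=
  single α (Matrix.single i j 1)

/-- The map `x ↦ a x` on `A₀`, for an algebraic multiplier `a`. -/
def multLeft (a : Malg n) : A₀ n →ₗ[ℂ] A₀ n where
  toFun x := ⟨a * x, by
    have hx : {α | (x : Malg n) α ≠ 0}.Finite := x.2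
    refine hx.subset fun α h h' => h ?_
    simp [h']⟩
  map_add' x y := Subtype.ext (mul_add a (x : Malg n) y)
  map_smul' c x := Subtype.ext (mul_smul_comm c a (x : Malg n))

/-- The map `x ↦ x a` on `A₀`, for an algebraic multiplier `a`. -/
def multRight (a : Malg n) : A₀ n →ₗ[ℂ] A₀ n where
  toFun x := ⟨x * a, by
    have hx : {α | (x : Malg n) α ≠ 0}.Finite := x.2
    refine hx.subset fun α h h' => h ?_
    simp [h']⟩
  map_add' x y := Subtype.ext (add_mul (x : Malg n) y a)
  map_smul' c x := Subtype.ext (smul_mul_assoc c (x : Malg n) a)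

/-- The elementary tensor `a ⊗ b` of algebraic multipliers, as a bilinear map. -/
def kron (n : I → ℕ) : Malg n →ₗ[ℂ] Malg n →ₗ[ℂ] Malg₂ n :=
  LinearMap.mk₂ ℂ (fun a b p => Matrix.kronecker (a p.1) (b p.2))
    (fun a a' b => funext fun p => Matrix.add_kronecker (a p.1) (a' p.1) (b p.2))
    (fun c a b => funext fun p => Matrix.smul_kronecker c (a p.1) (b p.2))
    (fun a b b' => funext fun p => Matrix.kronecker_add (a p.1) (b p.2) (b' p.2))
    (fun c a b => funext fun p => Matrix.kronecker_smul c (a p.1) (b p.2))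

/-- The inclusion of the algebraic tensor product `A₀ ⊗ A₀` in its algebraic multipliers. -/
def tensorIncl (n : I → ℕ) : A₀ n ⊗[ℂ] A₀ n →ₗ[ℂ] Malg₂ n :=
  TensorProduct.lift
    ((kron n).compl₁₂ (A₀ n).toNonUnitalSubalgebra.toSubmodule.subtype
      (A₀ n).toNonUnitalSubalgebra.toSubmodule.subtype)

/-- The component `X_{αβ} ∈ M_{n α} ⊗ M_{n β}` of an algebraic multiplier `X` of `A₀ ⊗ A₀`,
as an element of `A₀ ⊗ A₀`. -/
def component (X : Malg₂ n) (p : I × I) : A₀ n ⊗[ℂ] A₀ n :=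
  ∑ i, ∑ j, ∑ k, ∑ l, X p (i, k) (j, l) • (matrixUnit n p.1 i j ⊗ₜ[ℂ] matrixUnit n p.2 k l)

/-- The value `F(X) = ∑_{α,β} F(X_{αβ})` of a linear map `F` on `A₀ ⊗ A₀` at an algebraic
multiplier `X` for which only finitely many `F(X_{αβ})` are nonzero. -/
def evalMult {V : Type*} [AddCommGroup V] [Module ℂ V]
    (F : A₀ n ⊗[ℂ] A₀ n →ₗ[ℂ] V) (X : Malg₂ n) : V :=
  ∑ᶠ p : I × I, F (component X p)

/-- `A₀'`, the linear functionals on `A₀` that vanish on all but finitely many `M_{n α}`. -/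
def finSuppDual (n : I → ℕ) : Submodule ℂ (A₀ n →ₗ[ℂ] ℂ) where
  carrier := {f | {α | ∃ M, f (single α M) ≠ 0}.Finite}
  add_mem' := by
    intro f g hf hg
    refine (hf.union hg).subset ?_
    rintro α ⟨M, hM⟩
    by_contra h'
    simp only [Set.mem_union, Set.mem_ofPred_eq, not_or, not_exists, not_not] at h'
    exact hM (by simp [h'.1 M, h'.2 M])
  zero_mem' := by simp
  smul_mem' := by
    intro c f hf
    refine hf.subset ?_
    rintro α ⟨M, hM⟩
    exact ⟨M, fun h => hM (by simp [h])⟩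

/-- For a functional `ψ` on `A₀` and `a ∈ A₀`, the finitely supported functional
`ψ_a = ψ(a ·)`. -/
def leftTranslate (ψ : A₀ n →ₗ[ℂ] ℂ) (a : A₀ n) : finSuppDual n :=
  ⟨ψ ∘ₗ LinearMap.mulLeft ℂ a, by
    have ha : {α | (a : Malg n) α ≠ 0}.Finite := a.2
    refine ha.subset ?_
    rintro α ⟨M, hM⟩ h
    refine hM ?_
    have h0 : a * single α M = 0 := by
      refine Subtype.ext (funext fun β => ?_)
      classical
      change (a : Malg n) β * (Pi.single α M : Malg n) β = 0
      by_cases hβ : β = α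
      · subst hβ
        rw [h, zero_mul]
      · rw [Pi.single_eq_of_ne hβ, mul_zero]
    simp [h0]⟩

end DQG

open DQG

/-- A discrete quantum group `A₀ = ⊕_α M_{n α}`: a unital `*`-homomorphism
`Δ : M(A₀) → M(A₀ ⊗ A₀)` such that `T₁(a ⊗ b) = Δ(a)(1 ⊗ b)` and `T₂(a ⊗ b) = (a ⊗ 1)Δ(b)` define
linear bijections of the algebraic tensor product `A₀ ⊗ A₀` (the fields `T₁`, `T₂` are
determined by `Δ`), and such that `Δ` is coassociative. -/
structure DiscreteQuantumGroup (I : Type*) (n : I → ℕ) where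
  n_pos : ∀ α, 0 < n α
  Δ : Mbdd n →⋆ₐ[ℂ] Mbdd₂ n
  T₁ : A₀ n ⊗[ℂ] A₀ n ≃ₗ[ℂ] A₀ n ⊗[ℂ] A₀ n
  T₂ : A₀ n ⊗[ℂ] A₀ n ≃ₗ[ℂ] A₀ n ⊗[ℂ] A₀ n
  T₁_spec : ∀ a b : A₀ n,
    tensorIncl n (T₁ (a ⊗ₜ b)) = (Δ (toMbdd a) : Malg₂ n) * kron n 1 b
  T₂_spec : ∀ a b : A₀ n,
    tensorIncl n (T₂ (a ⊗ₜ b)) = kron n a 1 * (Δ (toMbdd b) : Malg₂ n)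
  /-- `(a ⊗ 1 ⊗ 1)(Δ ⊗ id)(Δ(b)(1 ⊗ c)) = (id ⊗ Δ)((a ⊗ 1)Δ(b))(1 ⊗ 1 ⊗ c)`, where
  `(a ⊗ 1 ⊗ 1)(Δ ⊗ id)(x ⊗ y) = T₂(a ⊗ x) ⊗ y` and
  `(id ⊗ Δ)(x ⊗ y)(1 ⊗ 1 ⊗ c) = x ⊗ T₁(y ⊗ c)`. -/
  coassoc : ∀ a b c : A₀ n,
    T₂.toLinearMap.rTensor (A₀ n)
        ((TensorProduct.assoc ℂ (A₀ n) (A₀ n) (A₀ n)).symm (a ⊗ₜ T₁ (b ⊗ₜ c)))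
      = (TensorProduct.assoc ℂ (A₀ n) (A₀ n) (A₀ n)).symm
          (T₁.toLinearMap.lTensor (A₀ n)
            (TensorProduct.assoc ℂ (A₀ n) (A₀ n) (A₀ n) (T₂ (a ⊗ₜ b) ⊗ₜ c)))

namespace DiscreteQuantumGroup

universe u

variable {I : Type u} {n : I → ℕ} (D : DiscreteQuantumGroup I n)

/-- `Δ(a)` for `a ∈ A₀`, as an algebraic multiplier of `A₀ ⊗ A₀`. -/
def comul (a : A₀ n) : Malg₂ n := (D.Δ (toMbdd a) : Malg₂ n)

/-- `(ε ⊗ id)(Δ(a)(1 ⊗ b)) = ab` and `(id ⊗ ε)((a ⊗ 1)Δ(b)) = ab`. -/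
def IsCounit (ε : A₀ n →ₗ[ℂ] ℂ) : Prop :=
  (∀ a b : A₀ n, TensorProduct.lid ℂ (A₀ n) (ε.rTensor (A₀ n) (D.T₁ (a ⊗ₜ b))) = a * b) ∧
  (∀ a b : A₀ n, TensorProduct.rid ℂ (A₀ n) (ε.lTensor (A₀ n) (D.T₂ (a ⊗ₜ b))) = a * b)

open Classical in
/-- The counit (the unique functional satisfying `IsCounit`). -/
def counit : A₀ n →ₗ[ℂ] ℂ :=
  if h : ∃ ε : A₀ n →ₗ[ℂ] ℂ, D.IsCounit ε then h.choose else 0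

/-- With `m` the multiplication of `A₀`, `m((S ⊗ id)(Δ(a)(1 ⊗ b))) = ε(a)b` and
`m((id ⊗ S)((a ⊗ 1)Δ(b))) = ε(b)a`. -/
def IsAntipode (S : A₀ n ≃ₗ[ℂ] A₀ n) : Prop :=
  (∀ a b : A₀ n, LinearMap.mul' ℂ (A₀ n) (S.toLinearMap.rTensor (A₀ n) (D.T₁ (a ⊗ₜ b)))
    = D.counit a • b) ∧
  (∀ a b : A₀ n, LinearMap.mul' ℂ (A₀ n) (S.toLinearMap.lTensor (A₀ n) (D.T₂ (a ⊗ₜ b)))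
    = D.counit b • a)

open Classical in
/-- The antipode `S` (the unique map satisfying `IsAntipode`); `S⁻¹` is `D.antipode.symm`. -/
def antipode : A₀ n ≃ₗ[ℂ] A₀ n :=
  if h : ∃ S : A₀ n ≃ₗ[ℂ] A₀ n, D.IsAntipode S then h.choose else LinearEquiv.refl ℂ (A₀ n)

/-- `φ` is a left Haar functional: positive, faithful, and left invariant, that is
`(id ⊗ φ)((b ⊗ 1)Δ(a)) = φ(a)b`. -/
structure IsLeftHaar (φ : A₀ n →ₗ[ℂ] ℂ) : Prop where
  positive : ∀ a : A₀ n, 0 ≤ φ (star a * a)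
  faithful : ∀ a : A₀ n, φ (star a * a) = 0 → a = 0
  left_invariant : ∀ a b : A₀ n,
    TensorProduct.rid ℂ (A₀ n) (φ.lTensor (A₀ n) (D.T₂ (b ⊗ₜ a))) = φ a • b

/-- `θ` is the positive square root of the modular element `δ` of `φ`, which is given by
`φ(S(a)) = φ(aδ)`. -/
structure IsModularRoot (φ : A₀ n →ₗ[ℂ] ℂ) (θ : Malg n) : Prop where
  posDef : ∀ α, (θ α).PosDef
  modular : ∀ a : A₀ n, φ (D.antipode a) = φ (multRight (θ * θ) a)

/-- The right Haar functional `ψ(a) = φ(aθ²)`. -/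
def rightHaar (φ : A₀ n →ₗ[ℂ] ℂ) (θ : Malg n) : A₀ n →ₗ[ℂ] ℂ :=
  φ ∘ₗ multRight (θ * θ)

/-- The convolution `(f ∗ g)(x) = (f ⊗ g)(Δ(x))` of finitely supported functionals. -/
def conv (f g : finSuppDual n) (x : A₀ n) : ℂ :=
  evalMult (LinearMap.mul' ℂ ℂ ∘ₗ TensorProduct.map f.1 g.1) (D.comul x)

/-- The adjoint `f*(x) = conj (f(S(x)*))`. -/
def adjoint (f : finSuppDual n) (x : A₀ n) : ℂ :=
  star (f.1 (star (D.antipode x)))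

/-- `a ∗ b = (id ⊗ ψ)((1 ⊗ b)((id ⊗ S⁻¹)(Δ(a))))`. -/
def prod (ψ : A₀ n →ₗ[ℂ] ℂ) (a b : A₀ n) : A₀ n :=
  evalMult
    ((TensorProduct.rid ℂ (A₀ n)).toLinearMap
      ∘ₗ TensorProduct.map LinearMap.id ψ
      ∘ₗ TensorProduct.map LinearMap.id (LinearMap.mulLeft ℂ b)
      ∘ₗ TensorProduct.map LinearMap.id D.antipode.symm.toLinearMap)
    (D.comul a)

/-- `(φ ⊗ id)((a ⊗ 1)((S ⊗ id)(Δ(b))))`. -/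
def prod' (φ : A₀ n →ₗ[ℂ] ℂ) (a b : A₀ n) : A₀ n :=
  evalMult
    ((TensorProduct.lid ℂ (A₀ n)).toLinearMap
      ∘ₗ TensorProduct.map φ LinearMap.id
      ∘ₗ TensorProduct.map (LinearMap.mulLeft ℂ a) LinearMap.id
      ∘ₗ TensorProduct.map D.antipode.toLinearMap LinearMap.id)
    (D.comul b)

/-- `a^♯ = θ⁻² S⁻¹(a*)`. -/
def sharp (θ : Malg n) (a : A₀ n) : A₀ n :=
  multLeft (fun α => (θ α)⁻¹ * (θ α)⁻¹) (D.antipode.symm (star a))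

end DiscreteQuantumGroup

/-- The complex vector space `V` with the product `mul` and the involution `inv` is an
associative (not necessarily unital) `*`-algebra. -/
structure IsComplexStarAlgebra {V : Type*} [AddCommGroup V] [Module ℂ V]
    (mul : V → V → V) (inv : V → V) : Prop where
  add_mul : ∀ a b c, mul (a + b) c = mul a c + mul b c
  mul_add : ∀ a b c, mul a (b + c) = mul a b + mul a c
  smul_mul : ∀ (r : ℂ) a b, mul (r • a) b = r • mul a b
  mul_smul : ∀ (r : ℂ) a b, mul a (r • b) = r • mul a b
  mul_assoc : ∀ a b c, mul (mul a b) c = mul a (mul b c)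
  inv_add : ∀ a b, inv (a + b) = inv a + inv b
  inv_smul : ∀ (r : ℂ) a, inv (r • a) = star r • inv a
  inv_mul : ∀ a b, inv (mul a b) = mul (inv b) (inv a)
  inv_inv : ∀ a, inv (inv a) = a

end

open DQG

open scoped TensorProduct ComplexOrder

noncomputable section

namespace DQG

universe u

variable {I : Type u} {n : I → ℕ}

/-! ### The algebraic direct sum -/

/-! Although Δ(a) is only a multiplier, a finitely supported functional absorbs a local unit. Hence
(id ⊗ f)Δ(b) and (f ⊗ id)Δ(b) are slices of the genuine tensors `T₁ (b ⊗ e)` and `T₂ (e ⊗ b)`. These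
operators, `rho f` and `lam f`, commute by coassociativity (`lam_rho_comm`), and the convolution f ∗
g is both f ∘ `rho g` and g ∘ `lam f`.

The counit and antipode are defined by choice, so their existence has to be proved. The counit is
read off from m ∘ T₁⁻¹, and the antipode from p S(x) = (id ⊗ ε)T₂⁻¹(p ⊗ x). Left invariance turns
the latter into strong invariance: S sends (id ⊗ φ)(Δ(a)(1 ⊗ c)) to (id ⊗ φ)((1 ⊗ a)Δ(c)). Such
elements span A₀, so this formula gives S(S(x)*) = x*, the bijectivity of S and the fact that S
flips Δ (`antipode_lam`).

The modular relation says ψ = φ ∘ S. Since S is antimultiplicative, a ∗ b is the slice of Δ(a) by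
φ(· S(b)). Strong invariance and the flip then give both the second formula for a ∗ b and ψ_a ∗ ψ_b
= ψ_{a∗b}.

The involution also needs φ(θ²a) = φ(aθ²). The two sides are φ(S⁻¹(a)) and φ(S(a)), which agree
because φ ∘ S² = φ. This follows from φ(ab) = φ(b S²(a)), obtained from the one-dimensional block
that carries ε (`exists_integral`, `apply_mul_antipode_antipode`). It follows that S(a^♯) = a*θ².
Faithfulness makes a ↦ ψ_a injective, so the algebra laws not visible from the formulas are
inherited from convolution and adjoint of functionals. -/

theorem A₀.ext {a b : A₀ n} (h : ∀ α, (a : Malg n) α = (b : Malg n) α) : a = b :=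
  Subtype.ext (funext h)

theorem A₀.mul_apply (a b : A₀ n) (α : I) :
    ((a * b : A₀ n) : Malg n) α = (a : Malg n) α * (b : Malg n) α := rfl

theorem A₀.star_apply (a : A₀ n) (α : I) :
    ((star a : A₀ n) : Malg n) α = star ((a : Malg n) α) := rfl

theorem A₀.sum_apply {J : Type*} (s : Finset J) (f : J → A₀ n) (α : I) :
    ((∑ j ∈ s, f j : A₀ n) : Malg n) α = ∑ j ∈ s, (f j : Malg n) α := by
  have h : ((∑ j ∈ s, f j : A₀ n) : Malg n) = ∑ j ∈ s, (f j : Malg n) :=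
    map_sum (A₀ n).toNonUnitalSubalgebra.toSubmodule.subtype f s
  rw [h, Finset.sum_apply]

theorem single_apply_same (α : I) (M : Matrix (Fin (n α)) (Fin (n α)) ℂ) :
    (single α M : Malg n) α = M := by
  classical
  exact Pi.single_eq_same (M := fun γ => Matrix (Fin (n γ)) (Fin (n γ)) ℂ) α M

theorem single_apply_ne {α β : I} (h : β ≠ α) (M : Matrix (Fin (n α)) (Fin (n α)) ℂ) :
    (single α M : Malg n) β = 0 := by
  classical
  exact Pi.single_eq_of_ne (M := fun γ => Matrix (Fin (n γ)) (Fin (n γ)) ℂ) h M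

theorem mul_single (a : A₀ n) (α : I) (M : Matrix (Fin (n α)) (Fin (n α)) ℂ) :
    a * single α M = single α ((a : Malg n) α * M) := by
  refine A₀.ext fun β => ?_
  rw [A₀.mul_apply]
  by_cases h : β = α
  · subst h
    rw [single_apply_same, single_apply_same]
  · rw [single_apply_ne h, single_apply_ne h, mul_zero]

theorem single_mul (a : A₀ n) (α : I) (M : Matrix (Fin (n α)) (Fin (n α)) ℂ) :
    single α M * a = single α (M * (a : Malg n) α) := by
  refine A₀.ext fun β => ?_
  rw [A₀.mul_apply]
  by_cases h : β = α
  · subst h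
    rw [single_apply_same, single_apply_same]
  · rw [single_apply_ne h, single_apply_ne h, zero_mul]

theorem star_single (α : I) (M : Matrix (Fin (n α)) (Fin (n α)) ℂ) :
    star (single α M : A₀ n) = single α (star M) := by
  refine A₀.ext fun β => ?_
  rw [A₀.star_apply]
  by_cases h : β = α
  · subst h
    rw [single_apply_same, single_apply_same]
  · rw [single_apply_ne h, single_apply_ne h, star_zero]

/-- `M ↦ single α M` as a linear map. -/
def singleₗ (n : I → ℕ) (α : I) : Matrix (Fin (n α)) (Fin (n α)) ℂ →ₗ[ℂ] A₀ n where
  toFun := single α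
  map_add' M N := by
    refine A₀.ext fun β => ?_
    change _ = (single α M : Malg n) β + (single α N : Malg n) β
    by_cases h : β = α
    · subst h
      simp only [single_apply_same]
    · simp only [single_apply_ne h, add_zero]
  map_smul' c M := by
    refine A₀.ext fun β => ?_
    change _ = c • (single α M : Malg n) β
    by_cases h : β = α
    · subst h
      simp only [single_apply_same]
    · simp only [single_apply_ne h, smul_zero]

theorem single_eq_sum (α : I) (M : Matrix (Fin (n α)) (Fin (n α)) ℂ) :
    (single α M : A₀ n) = ∑ i, ∑ j, M i j • matrixUnit n α i j := by
  change singleₗ n α M = _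
  conv_lhs => rw [Matrix.matrix_eq_sum_single M]
  simp only [map_sum]
  refine Finset.sum_congr rfl fun i _ => Finset.sum_congr rfl fun j _ => ?_
  rw [show matrixUnit n α i j = singleₗ n α (Matrix.single i j 1) from rfl, ← map_smul,
    Matrix.smul_single, smul_eq_mul, mul_one]

theorem sum_single_of_support_subset (a : A₀ n) (s : Finset I)
    (hs : ∀ α, α ∉ s → (a : Malg n) α = 0) : ∑ α ∈ s, single α ((a : Malg n) α) = a := by
  classical
  refine A₀.ext fun β => ?_
  rw [A₀.sum_apply]
  by_cases h : β ∈ s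
  · rw [Finset.sum_eq_single_of_mem β h fun γ _ hγ => single_apply_ne (Ne.symm hγ) _,
      single_apply_same]
  · rw [hs β h]
    exact Finset.sum_eq_zero fun γ hγ => single_apply_ne (fun hh => h (by rwa [hh])) _

theorem exists_support (a : A₀ n) : ∃ s : Finset I, ∀ α, α ∉ s → (a : Malg n) α = 0 := by
  have ha : {α | (a : Malg n) α ≠ 0}.Finite := a.2
  refine ⟨ha.toFinset, fun α h => ?_⟩
  by_contra h'
  exact h (ha.mem_toFinset.2 h')

open Classical in
/-- The sum of the units of the blocks with index in `s`. -/
def blockUnit (n : I → ℕ) (s : Finset I) : A₀ n :=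
  ⟨fun α => if α ∈ s then 1 else 0, by
    refine s.finite_toSet.subset fun α h => ?_
    by_contra h'
    exact h (if_neg h')⟩

theorem blockUnit_apply_mem {s : Finset I} {α : I} (h : α ∈ s) :
    (blockUnit n s : Malg n) α = 1 := if_pos h

theorem blockUnit_apply_notMem {s : Finset I} {α : I} (h : α ∉ s) :
    (blockUnit n s : Malg n) α = 0 := if_neg h

theorem star_blockUnit (s : Finset I) : star (blockUnit n s) = blockUnit n s := by
  refine A₀.ext fun α => ?_
  rw [A₀.star_apply]
  by_cases h : α ∈ s
  · rw [blockUnit_apply_mem h, star_one]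
  · rw [blockUnit_apply_notMem h, star_zero]

theorem blockUnit_mul_of {a : A₀ n} {s : Finset I} (hs : ∀ α, α ∉ s → (a : Malg n) α = 0) :
    blockUnit n s * a = a := by
  refine A₀.ext fun α => ?_
  rw [A₀.mul_apply]
  by_cases h : α ∈ s
  · rw [blockUnit_apply_mem h, one_mul]
  · rw [hs α h, mul_zero]

theorem mul_blockUnit_of {a : A₀ n} {s : Finset I} (hs : ∀ α, α ∉ s → (a : Malg n) α = 0) :
    a * blockUnit n s = a := by
  refine A₀.ext fun α => ?_
  rw [A₀.mul_apply]
  by_cases h : α ∈ s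
  · rw [blockUnit_apply_mem h, mul_one]
  · rw [hs α h, zero_mul]

theorem exists_localUnit (a : A₀ n) : ∃ e : A₀ n, star e = e ∧ e * a = a ∧ a * e = a := by
  obtain ⟨s, hs⟩ := exists_support a
  exact ⟨blockUnit n s, star_blockUnit s, blockUnit_mul_of hs, mul_blockUnit_of hs⟩

theorem eq_of_forall_mul_right {a b : A₀ n} (h : ∀ c, a * c = b * c) : a = b := by
  obtain ⟨s, hs⟩ := exists_support a
  obtain ⟨t, ht⟩ := exists_support b
  classical
  have h1 := h (blockUnit n (s ∪ t))
  rwa [mul_blockUnit_of fun α hα => hs α fun hh => hα (Finset.mem_union_left _ hh),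
    mul_blockUnit_of fun α hα => ht α fun hh => hα (Finset.mem_union_right _ hh)] at h1

theorem eq_of_forall_mul_left {a b : A₀ n} (h : ∀ c, c * a = c * b) : a = b := by
  obtain ⟨s, hs⟩ := exists_support a
  obtain ⟨t, ht⟩ := exists_support b
  classical
  have h1 := h (blockUnit n (s ∪ t))
  rwa [blockUnit_mul_of fun α hα => hs α fun hh => hα (Finset.mem_union_left _ hh),
    blockUnit_mul_of fun α hα => ht α fun hh => hα (Finset.mem_union_right _ hh)] at h1

/-! ### Finitely supported functionals -/

theorem functional_eq_zero {f : A₀ n →ₗ[ℂ] ℂ} {y : A₀ n}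
    (h : ∀ α, (∃ M, f (single α M) ≠ 0) → (y : Malg n) α = 0) : f y = 0 := by
  obtain ⟨s, hs⟩ := exists_support y
  rw [← sum_single_of_support_subset y s hs, map_sum]
  refine Finset.sum_eq_zero fun α _ => ?_
  by_contra h'
  refine h' ?_
  rw [h α ⟨_, h'⟩]
  exact (congrArg f (map_zero (singleₗ n α))).trans (map_zero f)

/-- The sum of the units of the blocks in the support of f works. It is the cover that replaces Δ(x)
by Δ(x)(1 ⊗ e) or (e ⊗ 1)Δ(x), which lie in A₀ ⊗ A₀. -/
theorem exists_localUnit_functional {f : A₀ n →ₗ[ℂ] ℂ} (hf : f ∈ finSuppDual n) :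
    ∃ e : A₀ n, (∀ x, f (e * x) = f x) ∧ ∀ x, f (x * e) = f x := by
  have hfin : {α | ∃ M, f (single α M) ≠ 0}.Finite := hf
  refine ⟨blockUnit n hfin.toFinset, fun x => ?_, fun x => ?_⟩
  · rw [← sub_eq_zero, ← map_sub]
    refine functional_eq_zero fun α hα => ?_
    change (blockUnit n _ : Malg n) α * (x : Malg n) α - (x : Malg n) α = 0
    rw [blockUnit_apply_mem (hfin.mem_toFinset.2 hα), one_mul, sub_self]
  · rw [← sub_eq_zero, ← map_sub]
    refine functional_eq_zero fun α hα => ?_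
    change (x : Malg n) α * (blockUnit n _ : Malg n) α - (x : Malg n) α = 0
    rw [blockUnit_apply_mem (hfin.mem_toFinset.2 hα), mul_one, sub_self]

theorem mem_finSuppDual_of_mul_left {f g : A₀ n →ₗ[ℂ] ℂ} {a : A₀ n}
    (h : ∀ x, f x = g (a * x)) : f ∈ finSuppDual n := by
  have h1 : f = (leftTranslate g a).1 := LinearMap.ext h
  rw [h1]
  exact (leftTranslate g a).2

theorem mem_finSuppDual_of_mul_right {f g : A₀ n →ₗ[ℂ] ℂ} {a : A₀ n}
    (h : ∀ x, f x = g (x * a)) : f ∈ finSuppDual n := by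
  have ha : {α | (a : Malg n) α ≠ 0}.Finite := a.2
  refine ha.subset ?_
  rintro α ⟨M, hM⟩ h0
  refine hM ?_
  rw [h, single_mul, h0, mul_zero]
  exact (congrArg g (map_zero (singleₗ n α))).trans (map_zero g)

/-! ### The tensor square and its multipliers -/

theorem kron_apply (a b : Malg n) (p : I × I) :
    kron n a b p = Matrix.kronecker (a p.1) (b p.2) := rfl

theorem kron_mul_kron (a b c d : Malg n) :
    kron n a b * kron n c d = kron n (a * c) (b * d) := by
  funext p
  exact (Matrix.mul_kronecker_mul _ _ _ _).symm

theorem tensorIncl_tmul (a b : A₀ n) : tensorIncl n (a ⊗ₜ b) = kron n a b := rfl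

theorem tensorIncl_tmul' (a b : A₀ n) :
    tensorIncl n (a ⊗ₜ b) = kron n a 1 * kron n 1 b := by
  rw [tensorIncl_tmul, kron_mul_kron, one_mul, mul_one]

theorem kron_comm (a b : Malg n) : kron n a 1 * kron n 1 b = kron n 1 b * kron n a 1 := by
  rw [kron_mul_kron, kron_mul_kron, one_mul, mul_one, one_mul, mul_one]

theorem component_kron (a b : A₀ n) (p : I × I) :
    component (kron n a b) p
      = single p.1 ((a : Malg n) p.1) ⊗ₜ[ℂ] single p.2 ((b : Malg n) p.2) := by
  rw [single_eq_sum, single_eq_sum]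
  rw [component, TensorProduct.sum_tmul]
  refine Finset.sum_congr rfl fun i _ => ?_
  rw [TensorProduct.sum_tmul]
  refine Finset.sum_congr rfl fun j _ => ?_
  rw [TensorProduct.tmul_sum]
  refine Finset.sum_congr rfl fun k _ => ?_
  rw [TensorProduct.tmul_sum]
  refine Finset.sum_congr rfl fun l _ => ?_
  exact (TensorProduct.smul_tmul_smul (R := ℂ) _ _ (matrixUnit n p.1 i j)
    (matrixUnit n p.2 k l)).symm

/-- `component` is linear in the multiplier. -/
def componentₗ (n : I → ℕ) (p : I × I) : Malg₂ n →ₗ[ℂ] A₀ n ⊗[ℂ] A₀ n where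
  toFun X := component X p
  map_add' X Y := by
    simp only [component, Pi.add_apply, Matrix.add_apply, add_smul, Finset.sum_add_distrib]
  map_smul' c X := by
    simp only [component, Pi.smul_apply, Matrix.smul_apply, smul_eq_mul, mul_smul,
      Finset.smul_sum, RingHom.id_apply]

theorem exists_sum_component (t : A₀ n ⊗[ℂ] A₀ n) :
    ∃ s : Finset (I × I), ∀ s', s ⊆ s' → ∑ p ∈ s', component (tensorIncl n t) p = t := by
  classical
  induction t with
  | zero =>
    refine ⟨∅, fun s' _ => Finset.sum_eq_zero fun p _ => ?_⟩
    rw [map_zero]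
    exact map_zero (componentₗ n p)
  | add x y hx hy =>
    obtain ⟨s, hs⟩ := hx
    obtain ⟨t, ht⟩ := hy
    refine ⟨s ∪ t, fun s' h => ?_⟩
    have h1 : ∀ p, component (tensorIncl n (x + y)) p
        = component (tensorIncl n x) p + component (tensorIncl n y) p := fun p => by
      rw [map_add (tensorIncl n)]
      exact map_add (componentₗ n p) _ _
    simp only [h1]
    rw [Finset.sum_add_distrib, hs s' (Finset.union_subset_left h),
      ht s' (Finset.union_subset_right h)]
  | tmul a b =>
    obtain ⟨s, hs⟩ := exists_support a
    obtain ⟨t, ht⟩ := exists_support b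
    refine ⟨s ×ˢ t, fun s' h => ?_⟩
    simp only [tensorIncl_tmul, component_kron]
    rw [← Finset.sum_subset h fun p _ hp => ?_]
    · rw [Finset.sum_product]
      simp only [← TensorProduct.tmul_sum, ← TensorProduct.sum_tmul]
      rw [sum_single_of_support_subset a s hs, sum_single_of_support_subset b t ht]
    · rw [Finset.mem_product, not_and_or] at hp
      rcases hp with hp | hp
      · rw [hs _ hp, show (single p.1 0 : A₀ n) = 0 from map_zero (singleₗ n p.1),
          TensorProduct.zero_tmul]
      · rw [ht _ hp, show (single p.2 0 : A₀ n) = 0 from map_zero (singleₗ n p.2),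
          TensorProduct.tmul_zero]

theorem component_tensorIncl_eq_zero {t : A₀ n ⊗[ℂ] A₀ n} {s : Finset (I × I)}
    (hs : ∀ s', s ⊆ s' → ∑ p ∈ s', component (tensorIncl n t) p = t) {p : I × I} (hp : p ∉ s) :
    component (tensorIncl n t) p = 0 := by
  classical
  have h := hs (insert p s) (Finset.subset_insert p s)
  rw [Finset.sum_insert hp, hs s subset_rfl] at h
  have key : ∀ {V : Type u} [AddCommGroup V] {x y : V}, x + y = y → x = 0 := fun h => by
    simpa using h
  exact key (V := A₀ n ⊗[ℂ] A₀ n) (y := t) h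

/-- A tensor is the sum of the components of its image. Identities between tensors can therefore be
checked among multipliers, where Δ(a) is itself an element. -/
theorem tensorIncl_injective : Function.Injective (tensorIncl n) := by
  rw [injective_iff_map_eq_zero]
  intro t h
  obtain ⟨s, hs⟩ := exists_sum_component t
  rw [← hs s subset_rfl]
  refine Finset.sum_eq_zero fun p _ => ?_
  rw [h]
  exact map_zero (componentₗ n p)

theorem evalMult_tensorIncl {V : Type*} [AddCommGroup V] [Module ℂ V]
    (F : A₀ n ⊗[ℂ] A₀ n →ₗ[ℂ] V) (t : A₀ n ⊗[ℂ] A₀ n) :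
    evalMult F (tensorIncl n t) = F t := by
  obtain ⟨s, hs⟩ := exists_sum_component t
  rw [evalMult, finsum_eq_sum_of_support_subset (s := s), ← map_sum, hs s subset_rfl]
  intro p hp
  by_contra h
  refine hp ?_
  change F _ = 0
  rw [component_tensorIncl_eq_zero hs h, map_zero]

open Classical in
theorem tensorIncl_component (X : Malg₂ n) (p : I × I) :
    tensorIncl n (component X p) = Pi.single p (X p) := by
  funext q
  have h1 : tensorIncl n (component X p) q = ∑ i, ∑ j, ∑ k, ∑ l, X p (i, k) (j, l) •
      Matrix.kronecker ((matrixUnit n p.1 i j : Malg n) q.1)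
        ((matrixUnit n p.2 k l : Malg n) q.2) := by
    simp only [component, map_sum, map_smul, tensorIncl_tmul, Finset.sum_apply, Pi.smul_apply,
      kron_apply]
  rw [h1]
  by_cases hq : q = p
  · subst hq
    rw [Pi.single_eq_same]
    simp only [matrixUnit, single_apply_same]
    conv_rhs => rw [Matrix.matrix_eq_sum_single (X q)]
    simp only [Fintype.sum_prod_type]
    refine Finset.sum_congr rfl fun i _ => ?_
    rw [Finset.sum_comm]
    refine Finset.sum_congr rfl fun k _ => Finset.sum_congr rfl fun j _ =>
      Finset.sum_congr rfl fun l _ => ?_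
    refine (congrArg _ (Matrix.single_kronecker_single i j k l (1 : ℂ) 1)).trans ?_
    rw [Matrix.smul_single, smul_eq_mul, mul_one, mul_one]
  · rw [Pi.single_eq_of_ne hq]
    refine Finset.sum_eq_zero fun i _ => Finset.sum_eq_zero fun j _ =>
      Finset.sum_eq_zero fun k _ => Finset.sum_eq_zero fun l _ => ?_
    rw [Prod.ext_iff, not_and_or] at hq
    rcases hq with hq | hq
    · rw [matrixUnit, single_apply_ne hq]
      exact (congrArg _ (Matrix.zero_kronecker _)).trans (smul_zero _)
    · rw [matrixUnit, matrixUnit, single_apply_ne hq]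
      exact (congrArg _ (Matrix.kronecker_zero _)).trans (smul_zero _)

/-- `t ↦ (a ⊗ 1) t`. -/
def mulLL (a : A₀ n) : A₀ n ⊗[ℂ] A₀ n →ₗ[ℂ] A₀ n ⊗[ℂ] A₀ n :=
  (LinearMap.mulLeft ℂ a).rTensor (A₀ n)

/-- `t ↦ (1 ⊗ a) t`. -/
def mulLR (a : A₀ n) : A₀ n ⊗[ℂ] A₀ n →ₗ[ℂ] A₀ n ⊗[ℂ] A₀ n :=
  (LinearMap.mulLeft ℂ a).lTensor (A₀ n)

/-- `t ↦ t (a ⊗ 1)`. -/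
def mulRL (a : A₀ n) : A₀ n ⊗[ℂ] A₀ n →ₗ[ℂ] A₀ n ⊗[ℂ] A₀ n :=
  (LinearMap.mulRight ℂ a).rTensor (A₀ n)

/-- `t ↦ t (1 ⊗ a)`. -/
def mulRR (a : A₀ n) : A₀ n ⊗[ℂ] A₀ n →ₗ[ℂ] A₀ n ⊗[ℂ] A₀ n :=
  (LinearMap.mulRight ℂ a).lTensor (A₀ n)

@[simp] theorem mulLL_tmul (a x y : A₀ n) : mulLL a (x ⊗ₜ y) = (a * x) ⊗ₜ y := rfl
@[simp] theorem mulLR_tmul (a x y : A₀ n) : mulLR a (x ⊗ₜ y) = x ⊗ₜ (a * y) := rfl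
@[simp] theorem mulRL_tmul (a x y : A₀ n) : mulRL a (x ⊗ₜ y) = (x * a) ⊗ₜ y := rfl
@[simp] theorem mulRR_tmul (a x y : A₀ n) : mulRR a (x ⊗ₜ y) = x ⊗ₜ (y * a) := rfl

theorem tensorIncl_mulLL (a : A₀ n) (t : A₀ n ⊗[ℂ] A₀ n) :
    tensorIncl n (mulLL a t) = kron n a 1 * tensorIncl n t := by
  induction t with
  | zero => simp only [map_zero, mul_zero]
  | add x y hx hy => simp only [map_add, mul_add, hx, hy]
  | tmul x y => rw [mulLL_tmul, tensorIncl_tmul, tensorIncl_tmul, kron_mul_kron, one_mul]; rfl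

theorem tensorIncl_mulLR (a : A₀ n) (t : A₀ n ⊗[ℂ] A₀ n) :
    tensorIncl n (mulLR a t) = kron n 1 a * tensorIncl n t := by
  induction t with
  | zero => simp only [map_zero, mul_zero]
  | add x y hx hy => simp only [map_add, mul_add, hx, hy]
  | tmul x y => rw [mulLR_tmul, tensorIncl_tmul, tensorIncl_tmul, kron_mul_kron, one_mul]; rfl

theorem tensorIncl_mulRL (a : A₀ n) (t : A₀ n ⊗[ℂ] A₀ n) :
    tensorIncl n (mulRL a t) = tensorIncl n t * kron n a 1 := by
  induction t with
  | zero => simp only [map_zero, zero_mul]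
  | add x y hx hy => simp only [map_add, add_mul, hx, hy]
  | tmul x y => rw [mulRL_tmul, tensorIncl_tmul, tensorIncl_tmul, kron_mul_kron, mul_one]; rfl

theorem tensorIncl_mulRR (a : A₀ n) (t : A₀ n ⊗[ℂ] A₀ n) :
    tensorIncl n (mulRR a t) = tensorIncl n t * kron n 1 a := by
  induction t with
  | zero => simp only [map_zero, zero_mul]
  | add x y hx hy => simp only [map_add, add_mul, hx, hy]
  | tmul x y => rw [mulRR_tmul, tensorIncl_tmul, tensorIncl_tmul, kron_mul_kron, mul_one]; rfl

theorem mulLL_component (a : A₀ n) (X : Malg₂ n) (p : I × I) :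
    mulLL a (component X p) = component (kron n a 1 * X) p := by
  classical
  refine tensorIncl_injective ?_
  rw [tensorIncl_mulLL, tensorIncl_component, tensorIncl_component, Pi.mul_apply]
  funext q
  rw [Pi.mul_apply]
  by_cases hq : q = p
  · subst hq
    rw [Pi.single_eq_same, Pi.single_eq_same]
  · rw [Pi.single_eq_of_ne hq, Pi.single_eq_of_ne hq, mul_zero]

theorem mulRR_component (a : A₀ n) (X : Malg₂ n) (p : I × I) :
    mulRR a (component X p) = component (X * kron n 1 a) p := by
  classical
  refine tensorIncl_injective ?_
  rw [tensorIncl_mulRR, tensorIncl_component, tensorIncl_component, Pi.mul_apply]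
  funext q
  rw [Pi.mul_apply]
  by_cases hq : q = p
  · subst hq
    rw [Pi.single_eq_same, Pi.single_eq_same]
  · rw [Pi.single_eq_of_ne hq, Pi.single_eq_of_ne hq, zero_mul]

/-- Since F factors through multiplication by a ⊗ 1, the possibly infinite sum over blocks only sees
(a ⊗ 1)X, a genuine tensor, and becomes a plain value of G. -/
theorem evalMult_comp_mulLL {V : Type*} [AddCommGroup V] [Module ℂ V]
    {F G : A₀ n ⊗[ℂ] A₀ n →ₗ[ℂ] V} {a : A₀ n} (hFG : ∀ x y, F (x ⊗ₜ y) = G ((a * x) ⊗ₜ y))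
    {X : Malg₂ n} {t : A₀ n ⊗[ℂ] A₀ n} (ht : tensorIncl n t = kron n a 1 * X) :
    evalMult F X = G t := by
  have h : F = G ∘ₗ mulLL a := TensorProduct.ext' hFG
  rw [← evalMult_tensorIncl, ht]
  simp only [evalMult, ← mulLL_component, h, LinearMap.comp_apply]

theorem evalMult_comp_mulRR {V : Type*} [AddCommGroup V] [Module ℂ V]
    {F G : A₀ n ⊗[ℂ] A₀ n →ₗ[ℂ] V} {a : A₀ n} (hFG : ∀ x y, F (x ⊗ₜ y) = G (x ⊗ₜ (y * a)))
    {X : Malg₂ n} {t : A₀ n ⊗[ℂ] A₀ n} (ht : tensorIncl n t = X * kron n 1 a) :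
    evalMult F X = G t := by
  have h : F = G ∘ₗ mulRR a := TensorProduct.ext' hFG
  rw [← evalMult_tensorIncl, ht]
  simp only [evalMult, ← mulRR_component, h, LinearMap.comp_apply]

/-! ### Slices -/

/-- The slice map `id ⊗ f`. -/
def sliceR (f : A₀ n →ₗ[ℂ] ℂ) : A₀ n ⊗[ℂ] A₀ n →ₗ[ℂ] A₀ n :=
  (TensorProduct.rid ℂ (A₀ n)).toLinearMap ∘ₗ f.lTensor (A₀ n)

/-- The slice map `f ⊗ id`. -/
def sliceL (f : A₀ n →ₗ[ℂ] ℂ) : A₀ n ⊗[ℂ] A₀ n →ₗ[ℂ] A₀ n :=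
  (TensorProduct.lid ℂ (A₀ n)).toLinearMap ∘ₗ f.rTensor (A₀ n)

@[simp] theorem sliceR_tmul (f : A₀ n →ₗ[ℂ] ℂ) (x y : A₀ n) :
    sliceR f (x ⊗ₜ y) = f y • x := rfl

@[simp] theorem sliceL_tmul (f : A₀ n →ₗ[ℂ] ℂ) (x y : A₀ n) :
    sliceL f (x ⊗ₜ y) = f x • y := rfl

/-- Slices by the coordinate functionals of a basis of the second leg are the coefficients of the
tensor in that basis. -/
theorem eq_of_forall_sliceR {s t : A₀ n ⊗[ℂ] A₀ n} (h : ∀ f, sliceR f s = sliceR f t) :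
    s = t := by
  classical
  let b := Module.Basis.ofVectorSpace ℂ (A₀ n)
  refine (TensorProduct.equivFinsuppOfBasisRight (M := A₀ n) b).injective ?_
  ext1 i
  rw [TensorProduct.equivFinsuppOfBasisRight_apply, TensorProduct.equivFinsuppOfBasisRight_apply]
  exact h (b.coord i)

end DQG

/-! ### Slices and associators in triple tensor products. -/

namespace TensorProduct

variable {k M N P Q : Type*} [CommSemiring k] [AddCommMonoid M] [AddCommMonoid N]
  [AddCommMonoid P] [AddCommMonoid Q] [Module k M] [Module k N] [Module k P] [Module k Q]

theorem assoc_symm_tmul_eq_rTensor (a : M) (t : N ⊗[k] P) :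
    (TensorProduct.assoc k M N P).symm (a ⊗ₜ t) = (TensorProduct.mk k M N a).rTensor P t := by
  induction t with
  | zero => simp
  | add x y hx hy => simp only [map_add, TensorProduct.tmul_add, hx, hy]
  | tmul x y => rfl

theorem assoc_tmul_eq_lTensor (c : P) (t : M ⊗[k] N) :
    TensorProduct.assoc k M N P (t ⊗ₜ c) = ((TensorProduct.mk k N P).flip c).lTensor M t := by
  induction t with
  | zero => simp
  | add x y hx hy => simp only [map_add, TensorProduct.add_tmul, hx, hy]
  | tmul x y => rfl

theorem rTensor_assoc_symm_tmul (U : M ⊗[k] N →ₗ[k] Q) (a : M) (t : N ⊗[k] P) :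
    U.rTensor P ((TensorProduct.assoc k M N P).symm (a ⊗ₜ t))
      = (U ∘ₗ TensorProduct.mk k M N a).rTensor P t := by
  rw [assoc_symm_tmul_eq_rTensor, LinearMap.rTensor_comp_apply]

theorem lTensor_assoc_tmul (U : N ⊗[k] P →ₗ[k] Q) (c : P) (t : M ⊗[k] N) :
    U.lTensor M (TensorProduct.assoc k M N P (t ⊗ₜ c))
      = (U ∘ₗ (TensorProduct.mk k N P).flip c).lTensor M t := by
  rw [assoc_tmul_eq_lTensor, LinearMap.lTensor_comp_apply]

theorem rid_lTensor_rTensor (f : P →ₗ[k] k) (r : M →ₗ[k] N) (t : M ⊗[k] P) :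
    TensorProduct.rid k N (f.lTensor N (r.rTensor P t))
      = r (TensorProduct.rid k M (f.lTensor M t)) := by
  induction t with
  | zero => simp
  | add x y hx hy => simp only [map_add, hx, hy]
  | tmul x y => simp

theorem lid_rTensor_lTensor (f : P →ₗ[k] k) (r : M →ₗ[k] N) (t : P ⊗[k] M) :
    TensorProduct.lid k N (f.rTensor N (r.lTensor P t))
      = r (TensorProduct.lid k M (f.rTensor M t)) := by
  induction t with
  | zero => simp
  | add x y hx hy => simp only [map_add, hx, hy]
  | tmul x y => simp

/-- Slicing the last leg of a triple tensor leaves the first leg untouched. This and its mirror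
image `lid_rTensor_assoc` turn coassociativity into statements about `rho` and `lam`. -/
theorem rid_lTensor_assoc_symm (f : P →ₗ[k] k) (r : N →ₗ[k] Q ⊗[k] P) (s : M ⊗[k] N) :
    TensorProduct.rid k (M ⊗[k] Q) (f.lTensor (M ⊗[k] Q)
        ((TensorProduct.assoc k M Q P).symm (r.lTensor M s)))
      = ((TensorProduct.rid k Q).toLinearMap ∘ₗ f.lTensor Q ∘ₗ r).lTensor M s := by
  induction s with
  | zero => simp
  | add x y hx hy => simp only [map_add, hx, hy]
  | tmul x y => rw [LinearMap.lTensor_tmul, assoc_symm_tmul_eq_rTensor, rid_lTensor_rTensor]; rfl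

theorem lid_rTensor_assoc (f : P →ₗ[k] k) (r : N →ₗ[k] P ⊗[k] Q) (s : N ⊗[k] M) :
    TensorProduct.lid k (Q ⊗[k] M) (f.rTensor (Q ⊗[k] M)
        (TensorProduct.assoc k P Q M (r.rTensor M s)))
      = ((TensorProduct.lid k Q).toLinearMap ∘ₗ f.rTensor Q ∘ₗ r).rTensor M s := by
  induction s with
  | zero => simp
  | add x y hx hy => simp only [map_add, hx, hy]
  | tmul x y => rw [LinearMap.rTensor_tmul, assoc_tmul_eq_lTensor, lid_rTensor_lTensor]; rfl

end TensorProduct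

/-! ### Translates and conjugates of functionals, and rules for slices. -/

namespace DQG

universe u

variable {I : Type u} {n : I → ℕ}

/-- The functional `x ↦ f (x a)`. -/
def rightTranslate (f : A₀ n →ₗ[ℂ] ℂ) (a : A₀ n) : finSuppDual n :=
  ⟨f ∘ₗ LinearMap.mulRight ℂ a, mem_finSuppDual_of_mul_right (g := f) (a := a) fun _ => rfl⟩

@[simp] theorem rightTranslate_apply (f : A₀ n →ₗ[ℂ] ℂ) (a x : A₀ n) :
    (rightTranslate f a).1 x = f (x * a) := rfl

@[simp] theorem leftTranslate_apply (f : A₀ n →ₗ[ℂ] ℂ) (a x : A₀ n) :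
    (leftTranslate f a).1 x = f (a * x) := rfl

/-- The functional `x ↦ conj (f (x*))`. -/
def starFunctional (f : A₀ n →ₗ[ℂ] ℂ) : A₀ n →ₗ[ℂ] ℂ where
  toFun x := star (f (star x))
  map_add' x y := by rw [star_add, map_add, star_add]
  map_smul' c x := by rw [star_smul, map_smul, star_smul, star_star, RingHom.id_apply]

@[simp] theorem starFunctional_apply (f : A₀ n →ₗ[ℂ] ℂ) (x : A₀ n) :
    starFunctional f x = star (f (star x)) := rfl

theorem starFunctional_mem {f : A₀ n →ₗ[ℂ] ℂ} (hf : f ∈ finSuppDual n) :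
    starFunctional f ∈ finSuppDual n := by
  obtain ⟨e, -, he⟩ := exists_localUnit_functional hf
  refine mem_finSuppDual_of_mul_left (g := starFunctional f) (a := star e) fun x => ?_
  rw [starFunctional_apply, starFunctional_apply, star_mul, star_star, he]

theorem star_matrixUnit (α : I) (i j : Fin (n α)) :
    star (matrixUnit n α i j) = matrixUnit n α j i := by
  rw [matrixUnit, star_single, matrixUnit, Matrix.star_eq_conjTranspose,
    Matrix.conjTranspose_single, star_one]

theorem evalMult_star (f g : A₀ n →ₗ[ℂ] ℂ) (X : Malg₂ n) :
    evalMult (LinearMap.mul' ℂ ℂ ∘ₗ TensorProduct.map f g) (star X)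
      = star (evalMult (LinearMap.mul' ℂ ℂ ∘ₗ
          TensorProduct.map (starFunctional f) (starFunctional g)) X) := by
  rw [evalMult, evalMult]
  -- Conjugation is an additive bijection, so it passes through `finsum` even when the support is
  -- infinite. What remains is one block, where the adjoint swaps the indices of the matrix units.
  refine Eq.trans (finsum_congr fun p => ?_)
    ((starAddEquiv (R := ℂ)).toAddMonoidHom.map_finsum_of_injective
      (starAddEquiv (R := ℂ)).injective _).symm
  change _ = star _
  simp only [component, map_sum, map_smul, LinearMap.comp_apply, TensorProduct.map_tmul,
    LinearMap.mul'_apply, smul_eq_mul, star_sum, starFunctional_apply, star_mul', star_star,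
    star_matrixUnit]
  rw [Finset.sum_comm]
  refine Finset.sum_congr rfl fun i _ => Finset.sum_congr rfl fun j _ => ?_
  rw [Finset.sum_comm]
  rfl

theorem mul_sliceR (f : A₀ n →ₗ[ℂ] ℂ) (c : A₀ n) (t : A₀ n ⊗[ℂ] A₀ n) :
    c * sliceR f t = sliceR f (mulLL c t) := by
  induction t with
  | zero => simp only [map_zero, mul_zero]
  | add x y hx hy => simp only [map_add, mul_add, hx, hy]
  | tmul x y => simp only [mulLL_tmul, sliceR_tmul, mul_smul_comm]

theorem sliceL_mul (f : A₀ n →ₗ[ℂ] ℂ) (c : A₀ n) (t : A₀ n ⊗[ℂ] A₀ n) :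
    sliceL f t * c = sliceL f (mulRR c t) := by
  induction t with
  | zero => simp only [map_zero, zero_mul]
  | add x y hx hy => simp only [map_add, add_mul, hx, hy]
  | tmul x y => simp only [mulRR_tmul, sliceL_tmul, smul_mul_assoc]

theorem sliceR_mulRR {f g : A₀ n →ₗ[ℂ] ℂ} {c : A₀ n} (h : ∀ y, f y = g (y * c))
    (t : A₀ n ⊗[ℂ] A₀ n) : sliceR g (mulRR c t) = sliceR f t := by
  induction t with
  | zero => simp only [map_zero]
  | add x y hx hy => simp only [map_add, hx, hy]
  | tmul x y => simp only [mulRR_tmul, sliceR_tmul, h]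

theorem sliceR_mulLR {f g : A₀ n →ₗ[ℂ] ℂ} {c : A₀ n} (h : ∀ y, f y = g (c * y))
    (t : A₀ n ⊗[ℂ] A₀ n) : sliceR g (mulLR c t) = sliceR f t := by
  induction t with
  | zero => simp only [map_zero]
  | add x y hx hy => simp only [map_add, hx, hy]
  | tmul x y => simp only [mulLR_tmul, sliceR_tmul, h]

theorem sliceL_mulLL {f g : A₀ n →ₗ[ℂ] ℂ} {c : A₀ n} (h : ∀ y, f y = g (c * y))
    (t : A₀ n ⊗[ℂ] A₀ n) : sliceL g (mulLL c t) = sliceL f t := by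
  induction t with
  | zero => simp only [map_zero]
  | add x y hx hy => simp only [map_add, hx, hy]
  | tmul x y => simp only [mulLL_tmul, sliceL_tmul, h]

theorem sliceL_apply_swap (f g : A₀ n →ₗ[ℂ] ℂ) (t : A₀ n ⊗[ℂ] A₀ n) :
    g (sliceL f t) = f (sliceR g t) := by
  induction t with
  | zero => simp only [map_zero]
  | add x y hx hy => simp only [map_add, hx, hy]
  | tmul x y => simp only [sliceL_tmul, sliceR_tmul, map_smul, smul_eq_mul, mul_comm]

theorem mul'_map_apply (f g : A₀ n →ₗ[ℂ] ℂ) (t : A₀ n ⊗[ℂ] A₀ n) :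
    (LinearMap.mul' ℂ ℂ ∘ₗ TensorProduct.map f g) t = f (sliceR g t) := by
  induction t with
  | zero => simp only [map_zero]
  | add x y hx hy => simp only [map_add, hx, hy]
  | tmul x y =>
    simp only [sliceR_tmul, map_smul, smul_eq_mul, LinearMap.comp_apply,
      TensorProduct.map_tmul, LinearMap.mul'_apply, mul_comm]

theorem sliceL_lTensor (f : A₀ n →ₗ[ℂ] ℂ) (r : A₀ n →ₗ[ℂ] A₀ n) (t : A₀ n ⊗[ℂ] A₀ n) :
    sliceL f (r.lTensor (A₀ n) t) = r (sliceL f t) := by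
  induction t with
  | zero => simp only [map_zero]
  | add x y hx hy => simp only [map_add, hx, hy]
  | tmul x y => simp only [LinearMap.lTensor_tmul, sliceL_tmul, map_smul]

theorem exists_functional_eq_one {a : A₀ n} (ha : a ≠ 0) :
    ∃ f : A₀ n →ₗ[ℂ] ℂ, f a = 1 := by
  by_contra! h
  refine ha ((Module.forall_dual_apply_eq_zero_iff ℂ a).1 fun f => ?_)
  by_contra hf
  refine h ((f a)⁻¹ • f) ?_
  rw [LinearMap.smul_apply, smul_eq_mul, inv_mul_cancel₀ hf]

end DQG

open DQG

namespace DiscreteQuantumGroup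

universe u

variable {I : Type u} {n : I → ℕ} (D : DiscreteQuantumGroup I n)

/-! ### Products and adjoints of `Δ(a)` -/

theorem comul_mul (a b : A₀ n) : D.comul (a * b) = D.comul a * D.comul b := by
  change ((D.Δ (toMbdd a * toMbdd b) : Mbdd₂ n) : Malg₂ n) = _
  rw [map_mul]
  rfl

theorem comul_star (a : A₀ n) : D.comul (star a) = star (D.comul a) := by
  change ((D.Δ (star (toMbdd a)) : Mbdd₂ n) : Malg₂ n) = _
  rw [map_star]
  rfl

theorem tensorIncl_T₁ (a b : A₀ n) :
    tensorIncl n (D.T₁ (a ⊗ₜ b)) = D.comul a * kron n 1 b := D.T₁_spec a b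

theorem tensorIncl_T₂ (a b : A₀ n) :
    tensorIncl n (D.T₂ (a ⊗ₜ b)) = kron n a 1 * D.comul b := D.T₂_spec a b

/-- Both sides are (c ⊗ 1)Δ(a)(1 ⊗ b); this is the bridge between `T₁` and `T₂`. -/
theorem mulLL_T₁ (a b c : A₀ n) :
    mulLL c (D.T₁ (a ⊗ₜ b)) = mulRR b (D.T₂ (c ⊗ₜ a)) := by
  refine tensorIncl_injective ?_
  rw [tensorIncl_mulLL, tensorIncl_mulRR, tensorIncl_T₁, tensorIncl_T₂, mul_assoc]

/-- `t ↦ Δ(a) t`. -/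
def comulMul (a : A₀ n) : A₀ n ⊗[ℂ] A₀ n →ₗ[ℂ] A₀ n ⊗[ℂ] A₀ n :=
  (LinearMap.mul' ℂ (A₀ n) ∘ₗ (TensorProduct.comm ℂ (A₀ n) (A₀ n)).toLinearMap).rTensor (A₀ n)
    ∘ₗ (TensorProduct.assoc ℂ (A₀ n) (A₀ n) (A₀ n)).symm.toLinearMap
    ∘ₗ (D.T₁.toLinearMap ∘ₗ TensorProduct.mk ℂ (A₀ n) (A₀ n) a).lTensor (A₀ n)

theorem comulMul_tmul (a p q : A₀ n) :
    D.comulMul a (p ⊗ₜ q) = mulRL p (D.T₁ (a ⊗ₜ q)) := by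
  exact TensorProduct.rTensor_assoc_symm_tmul _ p _

theorem tensorIncl_comulMul (a : A₀ n) (t : A₀ n ⊗[ℂ] A₀ n) :
    tensorIncl n (D.comulMul a t) = D.comul a * tensorIncl n t := by
  induction t with
  | zero => simp only [map_zero, mul_zero]
  | add x y hx hy => simp only [map_add, mul_add, hx, hy]
  | tmul x y =>
    rw [comulMul_tmul, tensorIncl_mulRL, tensorIncl_T₁, tensorIncl_tmul', mul_assoc, kron_comm]

/-- Multiplicativity of Δ expressed inside A₀ ⊗ A₀, the source of the multiplicativity of ε and the
antimultiplicativity of S. -/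
theorem T₁_mul_tmul (a b c : A₀ n) :
    D.T₁ ((a * b) ⊗ₜ c) = D.comulMul a (D.T₁ (b ⊗ₜ c)) := by
  refine tensorIncl_injective ?_
  rw [tensorIncl_comulMul, tensorIncl_T₁, tensorIncl_T₁, comul_mul, mul_assoc]

/-- `t ↦ t Δ(a)`. -/
def mulComul (a : A₀ n) : A₀ n ⊗[ℂ] A₀ n →ₗ[ℂ] A₀ n ⊗[ℂ] A₀ n :=
  (LinearMap.mul' ℂ (A₀ n) ∘ₗ (TensorProduct.comm ℂ (A₀ n) (A₀ n)).toLinearMap).lTensor (A₀ n)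
    ∘ₗ (TensorProduct.assoc ℂ (A₀ n) (A₀ n) (A₀ n)).toLinearMap
    ∘ₗ (D.T₂.toLinearMap ∘ₗ (TensorProduct.mk ℂ (A₀ n) (A₀ n)).flip a).rTensor (A₀ n)

theorem mulComul_tmul (a p q : A₀ n) :
    D.mulComul a (p ⊗ₜ q) = mulLR q (D.T₂ (p ⊗ₜ a)) := by
  exact TensorProduct.lTensor_assoc_tmul _ q _

theorem tensorIncl_mulComul (a : A₀ n) (t : A₀ n ⊗[ℂ] A₀ n) :
    tensorIncl n (D.mulComul a t) = tensorIncl n t * D.comul a := by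
  induction t with
  | zero => simp only [map_zero, zero_mul]
  | add x y hx hy => simp only [map_add, add_mul, hx, hy]
  | tmul x y =>
    rw [mulComul_tmul, tensorIncl_mulLR, tensorIncl_T₂, tensorIncl_tmul', kron_comm, mul_assoc]

theorem T₂_tmul_mul (a b c : A₀ n) :
    D.T₂ (a ⊗ₜ (b * c)) = D.mulComul c (D.T₂ (a ⊗ₜ b)) := by
  refine tensorIncl_injective ?_
  rw [tensorIncl_mulComul, tensorIncl_T₂, tensorIncl_T₂, comul_mul, mul_assoc]

/-! ### The actions of `A₀'` on `A₀` -/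

theorem evalMult_sliceR {f g : A₀ n →ₗ[ℂ] ℂ} {c : A₀ n} (h : ∀ y, f y = g (y * c)) (b : A₀ n) :
    evalMult (sliceR f) (D.comul b) = sliceR g (D.T₁ (b ⊗ₜ c)) :=
  evalMult_comp_mulRR (fun x y => by rw [sliceR_tmul, sliceR_tmul, h]) (D.tensorIncl_T₁ b c)

theorem evalMult_sliceL {f g : A₀ n →ₗ[ℂ] ℂ} {c : A₀ n} (h : ∀ y, f y = g (c * y)) (b : A₀ n) :
    evalMult (sliceL f) (D.comul b) = sliceL g (D.T₂ (c ⊗ₜ b)) :=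
  evalMult_comp_mulLL (fun x y => by rw [sliceL_tmul, sliceL_tmul, h]) (D.tensorIncl_T₂ c b)

/-- `b ↦ (id ⊗ f)(Δ(b))`. -/
def rho (f : finSuppDual n) : A₀ n →ₗ[ℂ] A₀ n where
  toFun b := evalMult (sliceR f.1) (D.comul b)
  map_add' a b := by
    obtain ⟨e, -, he⟩ := exists_localUnit_functional f.2
    simp only [D.evalMult_sliceR fun y => (he y).symm, TensorProduct.add_tmul, map_add]
  map_smul' c b := by
    obtain ⟨e, -, he⟩ := exists_localUnit_functional f.2
    simp only [D.evalMult_sliceR fun y => (he y).symm, ← TensorProduct.smul_tmul', map_smul,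
      RingHom.id_apply]

/-- `b ↦ (f ⊗ id)(Δ(b))`. -/
def lam (f : finSuppDual n) : A₀ n →ₗ[ℂ] A₀ n where
  toFun b := evalMult (sliceL f.1) (D.comul b)
  map_add' a b := by
    obtain ⟨e, he, -⟩ := exists_localUnit_functional f.2
    simp only [D.evalMult_sliceL fun y => (he y).symm, TensorProduct.tmul_add, map_add]
  map_smul' c b := by
    obtain ⟨e, he, -⟩ := exists_localUnit_functional f.2
    simp only [D.evalMult_sliceL fun y => (he y).symm, TensorProduct.tmul_smul, map_smul,
      RingHom.id_apply]

theorem rho_apply {f : finSuppDual n} {g : A₀ n →ₗ[ℂ] ℂ} {c : A₀ n}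
    (h : ∀ y, f.1 y = g (y * c)) (b : A₀ n) : D.rho f b = sliceR g (D.T₁ (b ⊗ₜ c)) :=
  D.evalMult_sliceR h b

theorem lam_apply {f : finSuppDual n} {g : A₀ n →ₗ[ℂ] ℂ} {c : A₀ n}
    (h : ∀ y, f.1 y = g (c * y)) (b : A₀ n) : D.lam f b = sliceL g (D.T₂ (c ⊗ₜ b)) :=
  D.evalMult_sliceL h b

theorem mul_rho (f : finSuppDual n) (b c : A₀ n) :
    c * D.rho f b = sliceR f.1 (D.T₂ (c ⊗ₜ b)) := by
  obtain ⟨e, -, he⟩ := exists_localUnit_functional f.2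
  rw [D.rho_apply fun y => (he y).symm, mul_sliceR, mulLL_T₁, sliceR_mulRR fun y => (he y).symm]

theorem lam_mul (f : finSuppDual n) (b c : A₀ n) :
    D.lam f b * c = sliceL f.1 (D.T₁ (b ⊗ₜ c)) := by
  obtain ⟨e, he, -⟩ := exists_localUnit_functional f.2
  rw [D.lam_apply fun y => (he y).symm, sliceL_mul, ← mulLL_T₁,
    sliceL_mulLL fun y => (he y).symm]

theorem apply_rho (f g : finSuppDual n) (x : A₀ n) : f.1 (D.rho g x) = D.conv f g x := by
  obtain ⟨e, -, he⟩ := exists_localUnit_functional g.2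
  rw [conv, evalMult_comp_mulRR (a := e) (fun x y => ?_) (D.tensorIncl_T₁ x e),
    mul'_map_apply, D.rho_apply fun y => (he y).symm]
  rw [mul'_map_apply, mul'_map_apply, sliceR_tmul, sliceR_tmul, he]

theorem apply_lam (f g : finSuppDual n) (x : A₀ n) : g.1 (D.lam f x) = D.conv f g x := by
  obtain ⟨e, he, -⟩ := exists_localUnit_functional f.2
  rw [conv, evalMult_comp_mulLL (a := e) (fun x y => ?_) (D.tensorIncl_T₂ e x),
    mul'_map_apply, D.lam_apply fun y => (he y).symm, sliceL_apply_swap]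
  rw [mul'_map_apply, mul'_map_apply, sliceR_tmul, sliceR_tmul, map_smul, map_smul, he]

/-- Coassociativity for (a, b, e), with e absorbed by f, sliced by f in the third leg. -/
theorem T₂_lTensor_rho (f : finSuppDual n) (t : A₀ n ⊗[ℂ] A₀ n) :
    D.T₂ ((D.rho f).lTensor (A₀ n) t) = (D.rho f).lTensor (A₀ n) (D.T₂ t) := by
  induction t with
  | zero => simp only [map_zero]
  | add x y hx hy => simp only [map_add, hx, hy]
  | tmul a b =>
    obtain ⟨e, -, he⟩ := exists_localUnit_functional f.2
    have h := congrArg (fun z => TensorProduct.rid ℂ (A₀ n ⊗[ℂ] A₀ n)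
      (f.1.lTensor (A₀ n ⊗[ℂ] A₀ n) z)) (D.coassoc a b e)
    rw [TensorProduct.rTensor_assoc_symm_tmul, TensorProduct.rid_lTensor_rTensor,
      TensorProduct.lTensor_assoc_tmul, TensorProduct.rid_lTensor_assoc_symm] at h
    have h' : (TensorProduct.rid ℂ (A₀ n)).toLinearMap ∘ₗ f.1.lTensor (A₀ n) ∘ₗ
        (D.T₁.toLinearMap ∘ₗ (TensorProduct.mk ℂ (A₀ n) (A₀ n)).flip e) = D.rho f :=
      LinearMap.ext fun y => (D.rho_apply (fun y => (he y).symm) y).symm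
    rw [h'] at h
    rw [LinearMap.lTensor_tmul, ← h, D.rho_apply fun y => (he y).symm]
    rfl

theorem T₁_rTensor_lam (f : finSuppDual n) (t : A₀ n ⊗[ℂ] A₀ n) :
    D.T₁ ((D.lam f).rTensor (A₀ n) t) = (D.lam f).rTensor (A₀ n) (D.T₁ t) := by
  induction t with
  | zero => simp only [map_zero]
  | add x y hx hy => simp only [map_add, hx, hy]
  | tmul b c =>
    obtain ⟨e, he, -⟩ := exists_localUnit_functional f.2
    have h := congrArg (fun z => TensorProduct.lid ℂ (A₀ n ⊗[ℂ] A₀ n)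
      (f.1.rTensor (A₀ n ⊗[ℂ] A₀ n) (TensorProduct.assoc ℂ (A₀ n) (A₀ n) (A₀ n) z)))
      (D.coassoc e b c)
    rw [TensorProduct.rTensor_assoc_symm_tmul, TensorProduct.lid_rTensor_assoc,
      LinearEquiv.apply_symm_apply, TensorProduct.lTensor_assoc_tmul,
      TensorProduct.lid_rTensor_lTensor] at h
    have h' : (TensorProduct.lid ℂ (A₀ n)).toLinearMap ∘ₗ f.1.rTensor (A₀ n) ∘ₗ
        (D.T₂.toLinearMap ∘ₗ TensorProduct.mk ℂ (A₀ n) (A₀ n) e) = D.lam f :=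
      LinearMap.ext fun y => (D.lam_apply (fun y => (he y).symm) y).symm
    rw [h'] at h
    rw [LinearMap.rTensor_tmul, h, D.lam_apply fun y => (he y).symm]
    rfl

/-- Both sides are (g ⊗ id ⊗ f) of the iterated comultiplication; this carries the associativity of
convolution. -/
theorem lam_rho_comm (f g : finSuppDual n) (b : A₀ n) :
    D.lam g (D.rho f b) = D.rho f (D.lam g b) := by
  obtain ⟨e, he, -⟩ := exists_localUnit_functional g.2
  rw [D.lam_apply fun y => (he y).symm, D.lam_apply fun y => (he y).symm, ← sliceL_lTensor,
    ← T₂_lTensor_rho, LinearMap.lTensor_tmul]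

theorem conv_star (f g f' g' : finSuppDual n) (hf : ∀ x, f'.1 x = star (f.1 (star x)))
    (hg : ∀ x, g'.1 x = star (g.1 (star x))) (x : A₀ n) :
    D.conv f g (star x) = star (D.conv f' g' x) := by
  have hf' : f'.1 = starFunctional f.1 := LinearMap.ext hf
  have hg' : g'.1 = starFunctional g.1 := LinearMap.ext hg
  rw [conv, conv, comul_star, evalMult_star, hf', hg']

/-! ### The counit -/

theorem mul'_rTensor_lam (f : finSuppDual n) (t : A₀ n ⊗[ℂ] A₀ n) :
    LinearMap.mul' ℂ (A₀ n) ((D.lam f).rTensor (A₀ n) t) = sliceL f.1 (D.T₁ t) := by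
  induction t with
  | zero => simp only [map_zero]
  | add x y hx hy => simp only [map_add, hx, hy]
  | tmul x y => rw [LinearMap.rTensor_tmul, LinearMap.mul'_apply, lam_mul]

/-- T₁⁻¹ commutes with `lam f` ⊗ id, and m ∘ (`lam f` ⊗ id) = (f ⊗ id) ∘ T₁, so T₁ cancels. -/
theorem mul'_T₁_symm_lam (f : finSuppDual n) (b c : A₀ n) :
    LinearMap.mul' ℂ (A₀ n) (D.T₁.symm (D.lam f b ⊗ₜ c)) = f.1 b • c := by
  have h : D.T₁.symm (D.lam f b ⊗ₜ c) = (D.lam f).rTensor (A₀ n) (D.T₁.symm (b ⊗ₜ c)) := by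
    rw [LinearEquiv.symm_apply_eq, T₁_rTensor_lam, LinearEquiv.apply_symm_apply,
      LinearMap.rTensor_tmul]
  rw [h, mul'_rTensor_lam, LinearEquiv.apply_symm_apply, sliceL_tmul]

/-- Surjectivity of `T₂` writes a ⊗ b as T₂(s), which makes f(a)b a sum of elements `lam (f(x ·))
y`; `mul'_T₁_symm_lam` applies to each. -/
theorem smul_mul'_T₁_symm (f : A₀ n →ₗ[ℂ] ℂ) (a b c : A₀ n) :
    f a • LinearMap.mul' ℂ (A₀ n) (D.T₁.symm (b ⊗ₜ c))
      = f (LinearMap.mul' ℂ (A₀ n) (D.T₂.symm (a ⊗ₜ b))) • c := by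
  have h : ∀ s : A₀ n ⊗[ℂ] A₀ n,
      LinearMap.mul' ℂ (A₀ n) (D.T₁.symm (sliceL f (D.T₂ s) ⊗ₜ c))
        = f (LinearMap.mul' ℂ (A₀ n) s) • c := by
    intro s
    induction s with
    | zero => simp only [map_zero, TensorProduct.zero_tmul, zero_smul]
    | add x y hx hy => simp only [map_add, TensorProduct.add_tmul, add_smul, hx, hy]
    | tmul x y =>
      rw [← D.lam_apply (f := leftTranslate f x) (fun _ => rfl), mul'_T₁_symm_lam]
      rfl
  rw [← h, LinearEquiv.apply_symm_apply, sliceL_tmul, ← TensorProduct.smul_tmul', map_smul,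
    map_smul]

/-- With f(a₀) = 1 fixed, `smul_mul'_T₁_symm` shows that m(T₁⁻¹(b ⊗ c)) is a scalar times c, and the
scalar is ε(b). Testing against all functionals shows that the same scalar serves `T₂`. -/
theorem exists_counit : ∃ ε : A₀ n →ₗ[ℂ] ℂ, D.IsCounit ε := by
  -- If A₀ = 0 there is no pair with f(a₀) = 1, and the zero functional is a counit.
  by_cases hA : ∀ a : A₀ n, a = 0
  · exact ⟨0, fun a b => (hA _).trans (hA _).symm, fun a b => (hA _).trans (hA _).symm⟩
  push Not at hA
  obtain ⟨a₀, ha₀⟩ := hA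
  obtain ⟨f, hf⟩ := exists_functional_eq_one ha₀
  let ε : A₀ n →ₗ[ℂ] ℂ := f ∘ₗ LinearMap.mul' ℂ (A₀ n) ∘ₗ D.T₂.symm.toLinearMap
    ∘ₗ TensorProduct.mk ℂ (A₀ n) (A₀ n) a₀
  have h1 : ∀ b c, LinearMap.mul' ℂ (A₀ n) (D.T₁.symm (b ⊗ₜ c)) = ε b • c := fun b c => by
    have h := D.smul_mul'_T₁_symm f a₀ b c
    rwa [hf, one_smul] at h
  have h2 : ∀ a b, LinearMap.mul' ℂ (A₀ n) (D.T₂.symm (a ⊗ₜ b)) = ε b • a := fun a b => by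
    rw [← sub_eq_zero]
    refine (Module.forall_dual_apply_eq_zero_iff ℂ _).1 fun g => ?_
    have h := D.smul_mul'_T₁_symm g a b a₀
    rw [h1] at h
    have h' := congrArg f h
    simp only [map_smul, hf, smul_eq_mul, mul_one] at h'
    rw [map_sub, ← h', map_smul, smul_eq_mul, mul_comm, sub_self]
  have h1' : ∀ t, sliceL ε t = LinearMap.mul' ℂ (A₀ n) (D.T₁.symm t) := fun t => by
    induction t with
    | zero => simp only [map_zero]
    | add x y hx hy => simp only [map_add, hx, hy]
    | tmul x y => rw [h1, sliceL_tmul]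
  have h2' : ∀ t, sliceR ε t = LinearMap.mul' ℂ (A₀ n) (D.T₂.symm t) := fun t => by
    induction t with
    | zero => simp only [map_zero]
    | add x y hx hy => simp only [map_add, hx, hy]
    | tmul x y => rw [h2, sliceR_tmul]
  refine ⟨ε, fun a b => ?_, fun a b => ?_⟩
  · change sliceL ε _ = _
    rw [h1', LinearEquiv.symm_apply_apply, LinearMap.mul'_apply]
  · change sliceR ε _ = _
    rw [h2', LinearEquiv.symm_apply_apply, LinearMap.mul'_apply]

theorem isCounit_counit : D.IsCounit D.counit := by
  rw [counit, dif_pos D.exists_counit]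
  exact D.exists_counit.choose_spec

theorem sliceL_counit_T₁ (t : A₀ n ⊗[ℂ] A₀ n) :
    sliceL D.counit (D.T₁ t) = LinearMap.mul' ℂ (A₀ n) t := by
  induction t with
  | zero => simp only [map_zero]
  | add x y hx hy => simp only [map_add, hx, hy]
  | tmul x y => exact D.isCounit_counit.1 x y

theorem sliceR_counit_T₂ (t : A₀ n ⊗[ℂ] A₀ n) :
    sliceR D.counit (D.T₂ t) = LinearMap.mul' ℂ (A₀ n) t := by
  induction t with
  | zero => simp only [map_zero]
  | add x y hx hy => simp only [map_add, hx, hy]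
  | tmul x y => exact D.isCounit_counit.2 x y

theorem counit_lam (f : finSuppDual n) (b : A₀ n) : D.counit (D.lam f b) = f.1 b := by
  obtain ⟨e, he, -⟩ := exists_localUnit_functional f.2
  rw [D.lam_apply fun y => (he y).symm, sliceL_apply_swap, sliceR_counit_T₂,
    LinearMap.mul'_apply, he]

theorem counit_rho (f : finSuppDual n) (b : A₀ n) : D.counit (D.rho f b) = f.1 b := by
  obtain ⟨e, -, he⟩ := exists_localUnit_functional f.2
  rw [D.rho_apply fun y => (he y).symm, ← sliceL_apply_swap, sliceL_counit_T₁,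
    LinearMap.mul'_apply, he]

/-- Multiplicativity of ε in disguise. As (ε ⊗ id)T₁ = m, slicing Δ(a)q by ε gives a times the slice
of q; for q = p ⊗ r this evaluates Δ(a)(1 ⊗ r)(p ⊗ 1), and such tensors without p span everything.
-/
theorem sliceL_counit_mulRL (p : A₀ n) (t : A₀ n ⊗[ℂ] A₀ n) :
    sliceL D.counit (mulRL p t) = D.counit p • sliceL D.counit t := by
  have key : ∀ a q, sliceL D.counit (D.comulMul a q) = a * sliceL D.counit q := by
    intro a q
    obtain ⟨t, rfl⟩ := D.T₁.surjective q
    induction t with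
    | zero => simp only [map_zero, mul_zero]
    | add x y hx hy => simp only [map_add, hx, hy, mul_add]
    | tmul x y => rw [← T₁_mul_tmul, sliceL_counit_T₁, sliceL_counit_T₁, LinearMap.mul'_apply,
        LinearMap.mul'_apply, mul_assoc]
  obtain ⟨s, rfl⟩ := D.T₁.surjective t
  induction s with
  | zero => simp only [map_zero, smul_zero]
  | add x y hx hy => simp only [map_add, hx, hy, smul_add]
  | tmul a q =>
    rw [← comulMul_tmul, key, sliceL_tmul, sliceL_counit_T₁, LinearMap.mul'_apply,
      mul_smul_comm]

theorem counit_mul (a b : A₀ n) : D.counit (a * b) = D.counit a * D.counit b := by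
  by_cases hA : a = 0
  · rw [hA, zero_mul, map_zero, zero_mul]
  have h := D.sliceL_counit_mulRL b (a ⊗ₜ a)
  rw [mulRL_tmul, sliceL_tmul, sliceL_tmul, smul_smul] at h
  rw [mul_comm (D.counit a)]
  obtain ⟨f, hf⟩ := exists_functional_eq_one hA
  have h' := congrArg f h
  simpa [hf] using h'

end DiscreteQuantumGroup

namespace DQG

variable {I : Type*} {n : I → ℕ}

theorem eq_of_forall_finSuppDual {a b : A₀ n} (h : ∀ f : finSuppDual n, f.1 a = f.1 b) :
    a = b := by
  refine eq_of_forall_mul_left fun c => ?_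
  rw [← sub_eq_zero]
  refine (Module.forall_dual_apply_eq_zero_iff ℂ _).1 fun f => ?_
  rw [map_sub, sub_eq_zero]
  exact h (leftTranslate f c)

end DQG

open DQG

namespace DiscreteQuantumGroup

universe u

variable {I : Type u} {n : I → ℕ} (D : DiscreteQuantumGroup I n)

/-! ### Separation, positivity and invariance -/

theorem star_rho {f f' : finSuppDual n} (hf : ∀ x, f'.1 x = star (f.1 (star x))) (b : A₀ n) :
    star (D.rho f b) = D.rho f' (star b) := by
  refine eq_of_forall_finSuppDual fun g => ?_
  have hf' : ∀ x, f.1 x = star (f'.1 (star x)) := fun x => by rw [hf, star_star, star_star]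
  have hg := D.conv_star g f' ⟨_, starFunctional_mem g.2⟩ f (fun _ => rfl) hf' b
  rw [← apply_rho, ← apply_rho] at hg
  rw [hg, starFunctional_apply, star_star]

theorem sliceR_haar_T₂ {φ : A₀ n →ₗ[ℂ] ℂ} (hφ : D.IsLeftHaar φ) (t : A₀ n ⊗[ℂ] A₀ n) :
    sliceR φ (D.T₂ t) = sliceR φ t := by
  induction t with
  | zero => simp only [map_zero]
  | add x y hx hy => simp only [map_add, hx, hy]
  | tmul x y => exact hφ.left_invariant y x

namespace IsLeftHaar

variable {D} {φ : A₀ n →ₗ[ℂ] ℂ} (hφ : D.IsLeftHaar φ)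

include hφ

/-- Polarisation: φ is real at x*x for x = a, e, a + e and a + ie, where the self-adjoint local unit
e plays the role of 1. -/
theorem apply_star (a : A₀ n) : φ (star a) = star (φ a) := by
  obtain ⟨e, he, h1, h2⟩ := exists_localUnit a
  have h2' : star a * e = star a := by
    have := congrArg star h1
    rwa [star_mul, he] at this
  have pos : ∀ x, (φ (star x * x)).im = 0 := fun x => ((Complex.le_def.1 (hφ.positive x)).2).symm
  have ha := pos a
  have hee := pos e
  have h3 := pos (a + e)
  have h4 := pos (a + Complex.I • e)
  rw [he] at hee
  simp only [star_add, star_smul, he, add_mul, mul_add, smul_mul_assoc, mul_smul_comm, h1, h2',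
    map_add, map_smul, Complex.add_im, smul_eq_mul, Complex.star_def, Complex.conj_I] at h3 h4
  simp only [Complex.mul_im, Complex.mul_re, Complex.neg_re, Complex.neg_im, Complex.I_re,
    Complex.I_im] at h4
  apply Complex.ext
  · rw [Complex.star_def, Complex.conj_re]
    linarith
  · rw [Complex.star_def, Complex.conj_im]
    linarith

theorem eq_zero_of_forall {a : A₀ n} (h : ∀ x, φ (x * a) = 0) : a = 0 :=
  hφ.faithful a (h _)

theorem eq_of_forall {a b : A₀ n} (h : ∀ x, φ (x * a) = φ (x * b)) : a = b := by
  rw [← sub_eq_zero]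
  refine hφ.eq_zero_of_forall fun x => ?_
  rw [mul_sub, map_sub, h, sub_self]

/-- Faithfulness gives x as the slice by φ of x ⊗ x*x / φ(x*x), and `T₁` is onto. Hence the elements
(id ⊗ φ)(Δ(a)(1 ⊗ c)) span A₀. -/
theorem exists_eq_sliceR_T₁ (x : A₀ n) : ∃ t, x = sliceR φ (D.T₁ t) := by
  by_cases hx : x = 0
  · exact ⟨0, by rw [hx, map_zero, map_zero]⟩
  have h : φ (star x * x) ≠ 0 := fun h => hx (hφ.faithful x h)
  refine ⟨D.T₁.symm (x ⊗ₜ ((φ (star x * x))⁻¹ • (star x * x))), ?_⟩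
  rw [LinearEquiv.apply_symm_apply, sliceR_tmul, map_smul, smul_eq_mul, inv_mul_cancel₀ h,
    one_smul]

theorem linearMap_ext {V : Type*} [AddCommMonoid V] [Module ℂ V] {g h : A₀ n →ₗ[ℂ] V}
    (hgh : ∀ a c, g (D.rho (rightTranslate φ c) a) = h (D.rho (rightTranslate φ c) a)) :
    g = h := by
  refine LinearMap.ext fun x => ?_
  obtain ⟨t, rfl⟩ := hφ.exists_eq_sliceR_T₁ x
  induction t with
  | zero => simp only [map_zero]
  | add x y hx hy => simp only [map_add, hx, hy]
  | tmul a c => rw [← D.rho_apply (f := rightTranslate φ c) (fun _ => rfl), hgh]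

end IsLeftHaar

/-! ### Existence of the antipode -/

theorem sliceR_counit_T₂_symm_rho (f : finSuppDual n) (p b : A₀ n) :
    sliceR D.counit (D.T₂.symm (p ⊗ₜ D.rho f b)) = sliceR f.1 (D.T₂.symm (p ⊗ₜ b)) := by
  have h : D.T₂.symm (p ⊗ₜ D.rho f b) = (D.rho f).lTensor (A₀ n) (D.T₂.symm (p ⊗ₜ b)) := by
    rw [LinearEquiv.symm_apply_eq, T₂_lTensor_rho, LinearEquiv.apply_symm_apply,
      LinearMap.lTensor_tmul]
  rw [h]
  generalize D.T₂.symm (p ⊗ₜ b) = t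
  induction t with
  | zero => simp only [map_zero]
  | add x y hx hy => simp only [map_add, hx, hy]
  | tmul x y => rw [LinearMap.lTensor_tmul, sliceR_tmul, sliceR_tmul, counit_rho]

theorem T₂_mulRR (c : A₀ n) (t : A₀ n ⊗[ℂ] A₀ n) :
    D.T₂ (mulRR c t) = D.mulComul c (D.T₂ t) := by
  induction t with
  | zero => simp only [map_zero]
  | add x y hx hy => simp only [map_add, hx, hy]
  | tmul x y => rw [mulRR_tmul, T₂_tmul_mul]

/-- Strong left invariance. As ε ∘ `rho f` = f, the left side is (id ⊗ φ)(T₂⁻¹(p ⊗ a)(1 ⊗ c)).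
Invariance allows `T₂` to be applied under the slice, which yields (id ⊗ φ)((p ⊗ a)Δ(c)). -/
theorem sliceR_counit_T₂_symm_haar {φ : A₀ n →ₗ[ℂ] ℂ} (hφ : D.IsLeftHaar φ) (p a c : A₀ n) :
    sliceR D.counit (D.T₂.symm (p ⊗ₜ D.rho (rightTranslate φ c) a))
      = p * D.rho (leftTranslate φ a) c := by
  rw [sliceR_counit_T₂_symm_rho, ← sliceR_mulRR (g := φ) (c := c) fun _ => rfl,
    ← D.sliceR_haar_T₂ hφ, T₂_mulRR, LinearEquiv.apply_symm_apply, mulComul_tmul,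
    sliceR_mulLR (f := (leftTranslate φ a).1) fun _ => rfl, mul_rho]

/-- The property `p S(x) = (id ⊗ ε)(T₂⁻¹(p ⊗ x))`. -/
def IsPreantipode (S : A₀ n →ₗ[ℂ] A₀ n) : Prop :=
  ∀ p x, p * S x = sliceR D.counit (D.T₂.symm (p ⊗ₜ x))

/-- On the spanning elements the right side has the form p s with s independent of p. Local units
make s unique, hence linear in x. -/
theorem exists_isPreantipode {φ : A₀ n →ₗ[ℂ] ℂ} (hφ : D.IsLeftHaar φ) :
    ∃ S, D.IsPreantipode S := by
  have h : ∀ x, ∃ s, ∀ p, p * s = sliceR D.counit (D.T₂.symm (p ⊗ₜ x)) := by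
    intro x
    obtain ⟨t, rfl⟩ := hφ.exists_eq_sliceR_T₁ x
    induction t with
    | zero => exact ⟨0, fun p => by simp only [mul_zero, map_zero, TensorProduct.tmul_zero]⟩
    | add x y hx hy =>
      obtain ⟨s, hs⟩ := hx
      obtain ⟨t, ht⟩ := hy
      exact ⟨s + t, fun p => by simp only [mul_add, hs, ht, map_add, TensorProduct.tmul_add]⟩
    | tmul a c =>
      refine ⟨D.rho (leftTranslate φ a) c, fun p => ?_⟩
      rw [← D.rho_apply (f := rightTranslate φ c) (fun _ => rfl), D.sliceR_counit_T₂_symm_haar hφ]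
  choose S hS using h
  refine ⟨⟨⟨S, fun x y => ?_⟩, fun r x => ?_⟩, fun p x => hS x p⟩
  · refine eq_of_forall_mul_left fun p => ?_
    rw [mul_add, hS, hS, hS, TensorProduct.tmul_add, map_add, map_add]
  · refine eq_of_forall_mul_left fun p => ?_
    change p * S (r • x) = p * (r • S x)
    rw [mul_smul_comm, hS, hS, TensorProduct.tmul_smul, map_smul, map_smul]

namespace IsPreantipode

variable {D} {S : A₀ n →ₗ[ℂ] A₀ n} (hS : D.IsPreantipode S)

include hS

theorem mul'_lTensor (t : A₀ n ⊗[ℂ] A₀ n) :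
    LinearMap.mul' ℂ (A₀ n) (S.lTensor (A₀ n) (D.T₂ t)) = sliceR D.counit t := by
  have h : ∀ t, LinearMap.mul' ℂ (A₀ n) (S.lTensor (A₀ n) t)
      = sliceR D.counit (D.T₂.symm t) := fun t => by
    induction t with
    | zero => simp only [map_zero]
    | add x y hx hy => simp only [map_add, hx, hy]
    | tmul x y => rw [LinearMap.lTensor_tmul, LinearMap.mul'_apply, hS]
  rw [h, LinearEquiv.symm_apply_apply]

/-- The defining property involves only `T₂`. It passes to `T₁` through (p S(·) ⊗ id)T₁(u ⊗ v) =
T₂⁻¹(p ⊗ u)(1 ⊗ v), checked by slicing the second leg; applying m finishes because m ∘ T₂⁻¹ = id ⊗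
ε. -/
theorem mul'_rTensor (t : A₀ n ⊗[ℂ] A₀ n) :
    LinearMap.mul' ℂ (A₀ n) (S.rTensor (A₀ n) (D.T₁ t)) = sliceL D.counit t := by
  induction t with
  | zero => simp only [map_zero]
  | add x y hx hy => simp only [map_add, hx, hy]
  | tmul u v =>
    refine eq_of_forall_mul_left fun p => ?_
    let r : A₀ n →ₗ[ℂ] A₀ n := LinearMap.mulLeft ℂ p ∘ₗ S
    have h1 : r.rTensor (A₀ n) (D.T₁ (u ⊗ₜ v)) = mulRR v (D.T₂.symm (p ⊗ₜ u)) := by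
      refine eq_of_forall_sliceR fun f => ?_
      rw [sliceR_mulRR (f := (rightTranslate f v).1) fun _ => rfl, ← sliceR_counit_T₂_symm_rho,
        ← hS, D.rho_apply (f := rightTranslate f v) fun _ => rfl]
      exact TensorProduct.rid_lTensor_rTensor f r _
    have h2 : ∀ t, LinearMap.mul' ℂ (A₀ n) (r.rTensor (A₀ n) t)
        = p * LinearMap.mul' ℂ (A₀ n) (S.rTensor (A₀ n) t) := fun t => by
      induction t with
      | zero => simp only [map_zero, mul_zero]
      | add x y hx hy => simp only [map_add, mul_add, hx, hy]
      | tmul x y => exact mul_assoc _ _ _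
    have h3 : ∀ t : A₀ n ⊗[ℂ] A₀ n, LinearMap.mul' ℂ (A₀ n) (mulRR v t)
        = LinearMap.mul' ℂ (A₀ n) t * v := fun t => by
      induction t with
      | zero => simp only [map_zero, zero_mul]
      | add x y hx hy => simp only [map_add, add_mul, hx, hy]
      | tmul x y => exact (mul_assoc _ _ _).symm
    rw [← h2, h1, h3, ← sliceR_counit_T₂, LinearEquiv.apply_symm_apply, sliceR_tmul,
      sliceL_tmul, smul_mul_assoc, mul_smul_comm]

/-- Put M = m ∘ (S ⊗ id). Then M(Δ(x)q) = ε(x)M(q), and evaluating on Δ(x)(b ⊗ y) gives M(t(b ⊗ 1))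
= S(b)M(t) for every t. Taking t = a ⊗ c concludes. -/
theorem apply_mul (a b : A₀ n) : S (a * b) = S b * S a := by
  have h1 : ∀ a q, LinearMap.mul' ℂ (A₀ n) (S.rTensor (A₀ n) (D.comulMul a q))
      = D.counit a • LinearMap.mul' ℂ (A₀ n) (S.rTensor (A₀ n) q) := by
    intro a q
    obtain ⟨t, rfl⟩ := D.T₁.surjective q
    induction t with
    | zero => simp only [map_zero, smul_zero]
    | add x y hx hy => simp only [map_add, hx, hy, smul_add]
    | tmul x y =>
      rw [← T₁_mul_tmul, hS.mul'_rTensor, hS.mul'_rTensor, sliceL_tmul, sliceL_tmul, counit_mul,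
        smul_smul]
  have h2 : ∀ t, LinearMap.mul' ℂ (A₀ n) (S.rTensor (A₀ n) (mulRL b t))
      = S b * LinearMap.mul' ℂ (A₀ n) (S.rTensor (A₀ n) t) := by
    intro t
    obtain ⟨s, rfl⟩ := D.T₁.surjective t
    induction s with
    | zero => simp only [map_zero, mul_zero]
    | add x y hx hy => simp only [map_add, hx, hy, mul_add]
    | tmul x y =>
      rw [← comulMul_tmul, h1, hS.mul'_rTensor, sliceL_tmul, LinearMap.rTensor_tmul,
        LinearMap.mul'_apply, mul_smul_comm]
  refine eq_of_forall_mul_right fun c => ?_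
  rw [mul_assoc]
  exact h2 (a ⊗ₜ c)

theorem apply_rho {φ : A₀ n →ₗ[ℂ] ℂ} (hφ : D.IsLeftHaar φ) (a c : A₀ n) :
    S (D.rho (rightTranslate φ c) a) = D.rho (leftTranslate φ a) c :=
  eq_of_forall_mul_left fun p => by rw [hS, D.sliceR_counit_T₂_symm_haar hφ]

/-- On a spanning element S exchanges the forms φ(· c) and φ(a ·) of strong invariance, and the
adjoint exchanges them back, so a second S lands on x*. -/
theorem apply_star_apply {φ : A₀ n →ₗ[ℂ] ℂ} (hφ : D.IsLeftHaar φ) (x : A₀ n) :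
    S (star (S x)) = star x := by
  obtain ⟨t, rfl⟩ := hφ.exists_eq_sliceR_T₁ x
  induction t with
  | zero => simp only [map_zero, star_zero]
  | add x y hx hy => simp only [map_add, star_add, hx, hy]
  | tmul a c =>
    rw [← D.rho_apply (f := rightTranslate φ c) (fun _ => rfl), hS.apply_rho hφ,
      D.star_rho (f' := rightTranslate φ (star a)), hS.apply_rho hφ,
      D.star_rho (f' := leftTranslate φ (star c))]
    · intro x
      rw [leftTranslate_apply, rightTranslate_apply, ← hφ.apply_star, star_mul, star_star]
    · intro x
      rw [leftTranslate_apply, rightTranslate_apply, ← hφ.apply_star, star_mul, star_star]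

theorem bijective {φ : A₀ n →ₗ[ℂ] ℂ} (hφ : D.IsLeftHaar φ) : Function.Bijective S := by
  refine ⟨fun x y h => ?_, fun x => ⟨star (S (star x)), ?_⟩⟩
  · rw [← star_star x, ← star_star y, ← hS.apply_star_apply hφ x, ← hS.apply_star_apply hφ y, h]
  · rw [hS.apply_star_apply hφ, star_star]

end IsPreantipode

theorem exists_antipode {φ : A₀ n →ₗ[ℂ] ℂ} (hφ : D.IsLeftHaar φ) :
    ∃ S : A₀ n ≃ₗ[ℂ] A₀ n, D.IsAntipode S := by
  obtain ⟨S, hS⟩ := D.exists_isPreantipode hφ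
  exact ⟨LinearEquiv.ofBijective S (hS.bijective hφ), fun a b => hS.mul'_rTensor (a ⊗ₜ b),
    fun a b => hS.mul'_lTensor (a ⊗ₜ b)⟩

theorem IsLeftHaar.isAntipode_antipode {D : DiscreteQuantumGroup I n} {φ : A₀ n →ₗ[ℂ] ℂ}
    (hφ : D.IsLeftHaar φ) : D.IsAntipode D.antipode := by
  rw [antipode, dif_pos (D.exists_antipode hφ)]
  exact (D.exists_antipode hφ).choose_spec

/-- The `T₂` axiom alone determines S, so the choice in `antipode` is harmless. -/
theorem IsAntipode.isPreantipode {D : DiscreteQuantumGroup I n} {S : A₀ n ≃ₗ[ℂ] A₀ n}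
    (hS : D.IsAntipode S) : D.IsPreantipode S.toLinearMap := by
  have h : ∀ t, LinearMap.mul' ℂ (A₀ n) (S.toLinearMap.lTensor (A₀ n) (D.T₂ t))
      = sliceR D.counit t := fun t => by
    induction t with
    | zero => simp only [map_zero]
    | add x y hx hy => simp only [map_add, hx, hy]
    | tmul x y => exact hS.2 x y
  intro p x
  rw [← h, LinearEquiv.apply_symm_apply, LinearMap.lTensor_tmul, LinearMap.mul'_apply]

end DiscreteQuantumGroup

/-! ### Matrix units and multiplication by unbounded families. -/

namespace DQG

universe u

variable {I : Type u} {n : I → ℕ}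

theorem exists_localUnit_pair (a b : A₀ n) : ∃ e : A₀ n, e * a = a ∧ b * e = b := by
  classical
  obtain ⟨s, hs⟩ := exists_support a
  obtain ⟨t, ht⟩ := exists_support b
  exact ⟨blockUnit n (s ∪ t),
    blockUnit_mul_of fun α hα => hs α fun hh => hα (Finset.mem_union_left _ hh),
    mul_blockUnit_of fun α hα => ht α fun hh => hα (Finset.mem_union_right _ hh)⟩

theorem single_zero (α : I) : (single α 0 : A₀ n) = 0 := map_zero (singleₗ n α)

theorem matrixUnit_mul_same (α : I) (i j k : Fin (n α)) :
    matrixUnit n α i j * matrixUnit n α j k = matrixUnit n α i k := by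
  rw [matrixUnit, matrixUnit, mul_single, single_apply_same, Matrix.single_mul_single_same,
    mul_one, matrixUnit]

theorem matrixUnit_mul_of_ne (α : I) (i l : Fin (n α)) {j k : Fin (n α)} (h : j ≠ k) :
    matrixUnit n α i j * matrixUnit n α k l = 0 := by
  rw [matrixUnit, matrixUnit, mul_single, single_apply_same,
    Matrix.single_mul_single_of_ne _ _ _ _ h, single_zero]

theorem matrixUnit_ne_zero (α : I) (i j : Fin (n α)) : matrixUnit n α i j ≠ 0 := by
  intro h
  have h1 : (matrixUnit n α i j : Malg n) α i j = 0 := by rw [h]; rfl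
  rw [matrixUnit, single_apply_same, Matrix.single_apply_same] at h1
  exact one_ne_zero h1

@[simp] theorem multRight_mul_assoc (m : Malg n) (a b : A₀ n) :
    multRight m (a * b) = a * multRight m b := Subtype.ext (mul_assoc _ _ _)

@[simp] theorem multLeft_mul_assoc (m : Malg n) (a b : A₀ n) :
    multLeft m (a * b) = multLeft m a * b := Subtype.ext (mul_assoc _ _ _).symm

theorem mul_multLeft (m : Malg n) (a b : A₀ n) : a * multLeft m b = multRight m a * b :=
  Subtype.ext (mul_assoc _ _ _).symm

theorem star_multRight (m : Malg n) (a : A₀ n) :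
    star (multRight m a) = multLeft (star m) (star a) := Subtype.ext (star_mul _ _)

theorem multLeft_multLeft_of_mul_eq_one {m m' : Malg n} (h : m * m' = 1) (a : A₀ n) :
    multLeft m (multLeft m' a) = a := by
  refine Subtype.ext ?_
  change m * (m' * (a : Malg n)) = a
  rw [← mul_assoc, h, one_mul]

theorem multRight_multRight_of_mul_eq_one {m m' : Malg n} (h : m * m' = 1) (a : A₀ n) :
    multRight m' (multRight m a) = a := by
  refine Subtype.ext ?_
  change (a : Malg n) * m * m' = a
  rw [mul_assoc, h, mul_one]

end DQG

open DQG

namespace DiscreteQuantumGroup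

universe u

variable {I : Type u} {n : I → ℕ} {D : DiscreteQuantumGroup I n}

namespace IsLeftHaar

variable {φ : A₀ n →ₗ[ℂ] ℂ} (hφ : D.IsLeftHaar φ)

include hφ

/-! ### The antipode and the comultiplication -/

theorem antipode_mul (a b : A₀ n) :
    D.antipode (a * b) = D.antipode b * D.antipode a :=
  hφ.isAntipode_antipode.isPreantipode.apply_mul a b

theorem antipode_rho (a c : A₀ n) :
    D.antipode (D.rho (rightTranslate φ c) a) = D.rho (leftTranslate φ a) c :=
  hφ.isAntipode_antipode.isPreantipode.apply_rho hφ a c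

theorem antipode_star_antipode (x : A₀ n) : D.antipode (star (D.antipode x)) = star x :=
  hφ.isAntipode_antipode.isPreantipode.apply_star_apply hφ x

theorem antipode_symm_mul (a b : A₀ n) :
    D.antipode.symm (a * b) = D.antipode.symm b * D.antipode.symm a := by
  rw [LinearEquiv.symm_apply_eq, hφ.antipode_mul, LinearEquiv.apply_symm_apply,
    LinearEquiv.apply_symm_apply]

theorem antipode_symm_eq (x : A₀ n) : D.antipode.symm x = star (D.antipode (star x)) := by
  rw [LinearEquiv.symm_apply_eq, hφ.antipode_star_antipode, star_star]

theorem comp_antipode_mem {f : A₀ n →ₗ[ℂ] ℂ} (hf : f ∈ finSuppDual n) :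
    f ∘ₗ D.antipode.toLinearMap ∈ finSuppDual n := by
  obtain ⟨e, -, he⟩ := exists_localUnit_functional hf
  refine mem_finSuppDual_of_mul_left (g := f ∘ₗ D.antipode.toLinearMap)
    (a := D.antipode.symm e) fun x => ?_
  change f (D.antipode x) = f (D.antipode _)
  rw [hφ.antipode_mul, LinearEquiv.apply_symm_apply, he]

/-- S flips Δ, in sliced form. On a spanning element, pairing either side with g gives φ(`lam f' a`
· `lam g c`), by strong invariance and the commutation of `lam` with `rho`. -/
theorem antipode_lam {f f' : finSuppDual n} (hf : ∀ x, f'.1 x = f.1 (D.antipode x))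
    (b : A₀ n) : D.antipode (D.lam f' b) = D.rho f (D.antipode b) := by
  have h : D.antipode.toLinearMap ∘ₗ D.lam f' = D.rho f ∘ₗ D.antipode.toLinearMap := by
    refine hφ.linearMap_ext fun a c => ?_
    change D.antipode (D.lam f' (D.rho _ a)) = D.rho f (D.antipode (D.rho _ a))
    rw [lam_rho_comm, hφ.antipode_rho, hφ.antipode_rho]
    refine eq_of_forall_finSuppDual fun g => ?_
    rw [apply_rho, apply_rho, ← apply_lam, ← apply_lam, lam_rho_comm, ← hφ.antipode_rho, ← hf,
      apply_rho, ← apply_lam]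
    rfl
  exact LinearMap.congr_fun h b

theorem conv_antipode {f f' g g' : finSuppDual n} (hf : ∀ x, f'.1 x = f.1 (D.antipode x))
    (hg : ∀ x, g'.1 x = g.1 (D.antipode x)) (x : A₀ n) :
    D.conv f' g' x = D.conv g f (D.antipode x) := by
  rw [← apply_lam, hg, hφ.antipode_lam hf, apply_rho]

/-! ### The modular automorphism -/

theorem eq_of_forall_right {a b : A₀ n} (h : ∀ x, φ (a * x) = φ (b * x)) : a = b := by
  refine star_injective (hφ.eq_of_forall fun x => ?_)
  have h1 : ∀ c : A₀ n, x * star c = star (c * star x) := fun c => by rw [star_mul, star_star]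
  rw [h1, h1, hφ.apply_star, hφ.apply_star, h]

/-- The counit is a nonzero multiplicative functional, so it is nonzero on some block, which must
have size 1; h is the unit of that block. -/
theorem exists_integral {a : A₀ n} (ha : a ≠ 0) :
    ∃ h : A₀ n, (∀ x, φ (x * h) = D.counit x * φ h) ∧ (∀ x, φ (h * x) = D.counit x * φ h)
      ∧ φ h ≠ 0 := by
  have h1 : ∃ x, D.counit x ≠ 0 := by
    by_contra! h0
    have h0' : D.counit = 0 := LinearMap.ext h0
    refine ha (eq_of_forall_mul_right fun b => ?_)
    rw [zero_mul, ← LinearMap.mul'_apply (R := ℂ), ← sliceL_counit_T₁, h0', sliceL,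
      LinearMap.rTensor_zero, LinearMap.comp_zero, LinearMap.zero_apply]
  obtain ⟨x, hx⟩ := h1
  have h2 : ∃ α M, D.counit (single α M) ≠ 0 := by
    by_contra! h0
    exact hx (functional_eq_zero fun α ⟨M, hM⟩ => absurd (h0 α M) hM)
  obtain ⟨α, M, hM⟩ := h2
  have h3 : ∃ i j, D.counit (matrixUnit n α i j) ≠ 0 := by
    by_contra! h0
    refine hM ?_
    simp only [single_eq_sum, map_sum, map_smul, h0, smul_zero, Finset.sum_const_zero]
  obtain ⟨i, j, hij⟩ := h3
  have h4 : D.counit (matrixUnit n α i i) ≠ 0 := by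
    rw [← matrixUnit_mul_same α i i j, counit_mul] at hij
    exact left_ne_zero_of_mul hij
  -- Two diagonal units of one block have equal counit, e_ii = e_ik e_ki and e_kk = e_ki e_ik, but
  -- product zero.
  have h5 : ∀ k, k = i := by
    intro k
    by_contra hk
    have h6 : D.counit (matrixUnit n α i i) = D.counit (matrixUnit n α k k) := by
      rw [← matrixUnit_mul_same α i k i, counit_mul, mul_comm, ← counit_mul,
        matrixUnit_mul_same]
    have h7 : D.counit (matrixUnit n α i i) * D.counit (matrixUnit n α k k) = 0 := by
      rw [← counit_mul, matrixUnit_mul_of_ne α i k (Ne.symm hk), map_zero]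
    rw [← h6] at h7
    exact h4 (mul_self_eq_zero.1 h7)
  have h8 : ∀ M : Matrix (Fin (n α)) (Fin (n α)) ℂ,
      (single α M : A₀ n) = M i i • matrixUnit n α i i := by
    intro M
    change singleₗ n α M = M i i • singleₗ n α _
    rw [← map_smul]
    congr 1
    ext k l
    obtain rfl := h5 k
    obtain rfl := h5 l
    simp
  have h9 : ∀ x : A₀ n, x * matrixUnit n α i i = D.counit x • matrixUnit n α i i := by
    intro x
    have h : x * matrixUnit n α i i = _ • matrixUnit n α i i := (mul_single x α _).trans (h8 _)
    have h' := congrArg D.counit h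
    rw [counit_mul, map_smul, smul_eq_mul] at h'
    rw [h, mul_right_cancel₀ h4 h']
  have h10 : ∀ x : A₀ n, matrixUnit n α i i * x = D.counit x • matrixUnit n α i i := by
    intro x
    have h : matrixUnit n α i i * x = _ • matrixUnit n α i i := (single_mul x α _).trans (h8 _)
    have h' := congrArg D.counit h
    rw [counit_mul, map_smul, smul_eq_mul, mul_comm] at h'
    rw [h, mul_right_cancel₀ h4 h']
  refine ⟨matrixUnit n α i i, fun x => ?_, fun x => ?_, fun h => ?_⟩
  · rw [h9, map_smul, smul_eq_mul]
  · rw [h10, map_smul, smul_eq_mul]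
  · refine matrixUnit_ne_zero α i i (hφ.faithful _ ?_)
    rw [star_matrixUnit, h9, map_smul, h, smul_zero]

/-- S² implements the modular automorphism of φ. Both φ(· h) and φ(h ·) equal φ(h)ε, so they act
through `rho` as the scalar φ(h). Strong invariance with c = h then gives φ(h)S(a) = (id ⊗ φ)((1 ⊗
a)Δ(h)), and applying φ(b S(·)) gives the claim times φ(h). -/
theorem apply_mul_antipode_antipode (a b : A₀ n) :
    φ (b * D.antipode (D.antipode a)) = φ (a * b) := by
  by_cases ha : a = 0
  · rw [ha, map_zero, map_zero, mul_zero, zero_mul]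
  obtain ⟨h, h1, h2, h3⟩ := hφ.exists_integral ha
  have h4 : ∀ x, D.rho (rightTranslate φ h) x = φ h • x := fun x => by
    refine eq_of_forall_finSuppDual fun g => ?_
    rw [apply_rho, ← apply_lam, rightTranslate_apply, h1, counit_lam, map_smul, smul_eq_mul,
      mul_comm]
  have h5 : ∀ x, D.rho (leftTranslate φ h) x = φ h • x := fun x => by
    refine eq_of_forall_finSuppDual fun g => ?_
    rw [apply_rho, ← apply_lam, leftTranslate_apply, h2, counit_lam, map_smul, smul_eq_mul,
      mul_comm]
  let f : finSuppDual n := ⟨_, hφ.comp_antipode_mem (leftTranslate φ b).2⟩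
  have hf : ∀ x, f.1 x = φ (b * D.antipode x) := fun _ => rfl
  have h6 : D.lam f h = φ h • b := by
    refine hφ.eq_of_forall_right fun c => ?_
    rw [← rightTranslate_apply, apply_lam, ← apply_rho, hf, hφ.antipode_rho, h5, mul_smul_comm,
      smul_mul_assoc]
  have h7 := congrArg f.1 (congrArg D.antipode (h4 a))
  rw [hφ.antipode_rho, apply_rho, ← apply_lam, h6, leftTranslate_apply, map_smul, map_smul, hf,
    mul_smul_comm, map_smul, smul_eq_mul, smul_eq_mul] at h7
  exact (mul_left_cancel₀ h3 h7).symm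

theorem apply_antipode_antipode (a : A₀ n) : φ (D.antipode (D.antipode a)) = φ a := by
  obtain ⟨e, h1, h2⟩ := exists_localUnit_pair (D.antipode (D.antipode a)) a
  have h := hφ.apply_mul_antipode_antipode a e
  rwa [h1, h2] at h

theorem apply_antipode_symm (a : A₀ n) : φ (D.antipode.symm a) = φ (D.antipode a) := by
  rw [← hφ.apply_antipode_antipode, LinearEquiv.apply_symm_apply]

/-! ### The dual product -/

section Dual

variable {ψ : A₀ n →ₗ[ℂ] ℂ} (hψ : ∀ x, ψ x = φ (D.antipode x))

include hψ

theorem prod_eq_rho (a b : A₀ n) :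
    D.prod ψ a b = D.rho (rightTranslate φ (D.antipode b)) a := by
  refine congrArg (fun F => evalMult F (D.comul a)) (TensorProduct.ext' fun x y => ?_)
  change ψ (b * D.antipode.symm y) • x = φ (y * D.antipode b) • x
  rw [hψ, hφ.antipode_mul, LinearEquiv.apply_symm_apply]

/-- S maps both sides to (id ⊗ φ(a ·))Δ(S(b)): the left one by strong invariance, the right one
because S flips Δ. -/
theorem prod_eq_prod' (a b : A₀ n) : D.prod ψ a b = D.prod' φ a b := by
  let f : finSuppDual n := ⟨_, hφ.comp_antipode_mem (leftTranslate φ a).2⟩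
  have h : D.prod' φ a b = D.lam f b :=
    congrArg (fun F => evalMult F (D.comul b)) (TensorProduct.ext' fun x y => rfl)
  refine D.antipode.injective ?_
  rw [hφ.prod_eq_rho hψ, h, hφ.antipode_rho, hφ.antipode_lam (f := leftTranslate φ a)]
  exact fun _ => rfl

/-- Strong invariance of the right Haar functional ψ, transported from that of φ by one more
application of S. -/
theorem antipode_lam_leftTranslate (a x : A₀ n) :
    D.antipode (D.lam (leftTranslate ψ a) x) = D.lam (rightTranslate ψ x) a := by
  refine D.antipode.injective ?_
  rw [hφ.antipode_lam (f := rightTranslate φ (D.antipode a)), hφ.antipode_rho,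
    hφ.antipode_lam (f := leftTranslate φ (D.antipode x))]
  · intro y
    rw [rightTranslate_apply, leftTranslate_apply, hψ, hφ.antipode_mul]
  · intro y
    rw [rightTranslate_apply, leftTranslate_apply, hψ, hφ.antipode_mul]

theorem conv_leftTranslate (a b x : A₀ n) :
    D.conv (leftTranslate ψ a) (leftTranslate ψ b) x = ψ (D.prod ψ a b * x) := by
  rw [← apply_lam, leftTranslate_apply, hψ, hφ.antipode_mul,
    hφ.antipode_lam_leftTranslate hψ, ← rightTranslate_apply, apply_lam, ← apply_rho,
    rightTranslate_apply, hφ.prod_eq_rho hψ]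

theorem eq_of_forall_dual {a b : A₀ n} (h : ∀ x, ψ (a * x) = ψ (b * x)) : a = b := by
  refine D.antipode.injective (hφ.eq_of_forall fun x => ?_)
  have h1 := h (D.antipode.symm x)
  rwa [hψ, hψ, hφ.antipode_mul, hφ.antipode_mul, LinearEquiv.apply_symm_apply] at h1

theorem prod_assoc (a b c : A₀ n) :
    D.prod ψ (D.prod ψ a b) c = D.prod ψ a (D.prod ψ b c) := by
  refine hφ.eq_of_forall_dual hψ fun x => ?_
  rw [← hφ.conv_leftTranslate hψ, ← hφ.conv_leftTranslate hψ, ← apply_rho, ← apply_lam,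
    leftTranslate_apply, leftTranslate_apply, ← hφ.conv_leftTranslate hψ,
    ← hφ.conv_leftTranslate hψ, ← apply_lam, ← apply_rho, lam_rho_comm]

theorem apply_prod_mul (a b x : A₀ n) :
    ψ (D.prod ψ a b * x) = ψ (b * D.lam (leftTranslate ψ a) x) := by
  rw [← hφ.conv_leftTranslate hψ, ← apply_lam, leftTranslate_apply]

end Dual

/-! ### The modular element -/

section Modular

variable {θ : Malg n} (hθ : D.IsModularRoot φ θ)

include hθ

/-- The adjoint of the modular relation, with S⁻¹(a) = S(a*)*. -/
theorem apply_multLeft_eq (a : A₀ n) : φ (multLeft (θ * θ) a) = φ (D.antipode.symm a) := by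
  have hs : star (θ * θ) = θ * θ := by
    have h : star θ = θ := funext fun α => (hθ.posDef α).1
    rw [star_mul, h]
  rw [hφ.antipode_symm_eq, hφ.apply_star, hθ.modular, ← hφ.apply_star, star_multRight, hs,
    star_star]

theorem apply_multLeft_eq_multRight (a : A₀ n) :
    φ (multLeft (θ * θ) a) = φ (multRight (θ * θ) a) := by
  rw [hφ.apply_multLeft_eq hθ, hφ.apply_antipode_symm, hθ.modular]

/-- This is S(θ²) = θ⁻², stated without extending S to multipliers. Pairing with x under φ turns
both sides into φ(S(S⁻¹(x)z)). -/
theorem multLeft_antipode_multRight (z : A₀ n) :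
    multLeft (θ * θ) (D.antipode (multRight (θ * θ) z)) = D.antipode z := by
  refine hφ.eq_of_forall_right fun x => ?_
  rw [← multLeft_mul_assoc, hφ.apply_multLeft_eq hθ, hφ.antipode_symm_mul,
    LinearEquiv.symm_apply_apply, ← multRight_mul_assoc, ← hθ.modular, hφ.antipode_mul,
    LinearEquiv.apply_symm_apply]

theorem antipode_sharp (a : A₀ n) :
    D.antipode (D.sharp θ a) = multRight (θ * θ) (star a) := by
  have hi : ∀ α, θ α * (θ α)⁻¹ = 1 ∧ (θ α)⁻¹ * θ α = 1 := fun α =>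
    have h := (Matrix.isUnit_iff_isUnit_det _).1 (hθ.posDef α).isUnit
    ⟨Matrix.mul_nonsing_inv _ h, Matrix.nonsing_inv_mul _ h⟩
  have h1 : θ * θ * (fun α => (θ α)⁻¹ * (θ α)⁻¹ : Malg n) = 1 := funext fun α => by
    change θ α * θ α * ((θ α)⁻¹ * (θ α)⁻¹) = 1
    rw [mul_assoc, ← mul_assoc (θ α) (θ α)⁻¹, (hi α).1, one_mul, (hi α).1]
  have h2 : (fun α => (θ α)⁻¹ * (θ α)⁻¹ : Malg n) * (θ * θ) = 1 := funext fun α => by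
    change (θ α)⁻¹ * (θ α)⁻¹ * (θ α * θ α) = 1
    rw [mul_assoc, ← mul_assoc (θ α)⁻¹ (θ α), (hi α).2, one_mul, (hi α).2]
  refine eq_of_forall_mul_right fun x => ?_
  -- Every test element has the form S(zθ²), on which left multiplication by θ² is known.
  obtain ⟨y, rfl⟩ := D.antipode.surjective x
  rw [← mul_multLeft]
  obtain ⟨z, rfl⟩ : ∃ z, multRight (θ * θ) z = y :=
    ⟨_, multRight_multRight_of_mul_eq_one h2 y⟩
  rw [hφ.multLeft_antipode_multRight hθ, ← hφ.antipode_mul, ← mul_multLeft, sharp,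
    multLeft_multLeft_of_mul_eq_one h1, hφ.antipode_mul, LinearEquiv.apply_symm_apply]

theorem adjoint_leftTranslate {ψ : A₀ n →ₗ[ℂ] ℂ} (hψ : ∀ x, ψ x = φ (D.antipode x))
    (a x : A₀ n) : D.adjoint (leftTranslate ψ a) x = ψ (D.sharp θ a * x) := by
  have hs : star (θ * θ) = θ * θ := by
    have h : star θ = θ := funext fun α => (hθ.posDef α).1
    rw [star_mul, h]
  rw [adjoint, leftTranslate_apply, hψ, hψ, hθ.modular, ← hφ.apply_star, star_multRight, hs,
    hφ.apply_multLeft_eq_multRight hθ, star_mul, star_star, multRight_mul_assoc,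
    ← hφ.antipode_sharp hθ, hφ.antipode_mul]

theorem isComplexStarAlgebra {ψ : A₀ n →ₗ[ℂ] ℂ} (hψ : ∀ x, ψ x = φ (D.antipode x)) :
    IsComplexStarAlgebra (D.prod ψ) (D.sharp θ) where
  add_mul a b c := by simp only [hφ.prod_eq_rho hψ, map_add]
  mul_add a b c := by
    refine hφ.eq_of_forall_dual hψ fun x => ?_
    simp only [add_mul, map_add, hφ.apply_prod_mul hψ]
  smul_mul r a b := by simp only [hφ.prod_eq_rho hψ, map_smul]
  mul_smul r a b := by
    refine hφ.eq_of_forall_dual hψ fun x => ?_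
    simp only [smul_mul_assoc, map_smul, hφ.apply_prod_mul hψ]
  mul_assoc := hφ.prod_assoc hψ
  inv_add a b := by simp only [sharp, star_add, map_add]
  inv_smul r a := by simp only [sharp, star_smul, map_smul]
  inv_mul a b := by
    -- Under the injection a ↦ ψ_a this is (f ∗ g)* = g* ∗ f*: the adjoint of A₀ respects Δ and S
    -- flips it.
    refine hφ.eq_of_forall_dual hψ fun x => ?_
    rw [← hφ.adjoint_leftTranslate hθ hψ, adjoint, leftTranslate_apply,
      ← hφ.conv_leftTranslate hψ, D.conv_star _ _ ⟨_, starFunctional_mem (leftTranslate ψ a).2⟩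
      ⟨_, starFunctional_mem (leftTranslate ψ b).2⟩ (fun _ => rfl) (fun _ => rfl), star_star,
      ← hφ.conv_antipode (f' := leftTranslate ψ (D.sharp θ b))
        (g' := leftTranslate ψ (D.sharp θ a)), hφ.conv_leftTranslate hψ]
    · exact fun x => (hφ.adjoint_leftTranslate hθ hψ b x).symm
    · exact fun x => (hφ.adjoint_leftTranslate hθ hψ a x).symm
  inv_inv a := by
    refine hφ.eq_of_forall_dual hψ fun x => ?_
    rw [← hφ.adjoint_leftTranslate hθ hψ, adjoint, leftTranslate_apply,
      ← hφ.adjoint_leftTranslate hθ hψ, adjoint, leftTranslate_apply, star_star,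
      hφ.antipode_star_antipode, star_star]

end Modular

end IsLeftHaar

end DiscreteQuantumGroup

end

open DQG
theorem mainTheorem6 {I : Type*} {n : I → ℕ} (D : DiscreteQuantumGroup I n)
    (φ : A₀ n →ₗ[ℂ] ℂ) (hφ : D.IsLeftHaar φ)
    (θ : Malg n) (hθ : D.IsModularRoot φ θ)
    (ψ : A₀ n →ₗ[ℂ] ℂ) (hψ : ψ = DiscreteQuantumGroup.rightHaar φ θ) :
    (∀ a b : A₀ n, D.prod ψ a b = D.prod' φ a b) ∧
    (∀ a b x : A₀ n,
      D.conv (leftTranslate ψ a) (leftTranslate ψ b) x = (leftTranslate ψ (D.prod ψ a b)).1 x) ∧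
    (∀ a x : A₀ n, D.adjoint (leftTranslate ψ a) x = (leftTranslate ψ (D.sharp θ a)).1 x) ∧
    Function.Injective (leftTranslate ψ) ∧
    IsComplexStarAlgebra (D.prod ψ) (D.sharp θ) := by
  -- The dual-product lemmas use ψ only in the form φ ∘ S.
  have hψ' : ∀ x, ψ x = φ (D.antipode x) := fun x => by
    rw [hψ, hθ.modular]
    rfl
  exact ⟨hφ.prod_eq_prod' hψ', hφ.conv_leftTranslate hψ', hφ.adjoint_leftTranslate hθ hψ',
    fun a b h => hφ.eq_of_forall_dual hψ' fun x =>
      LinearMap.congr_fun (congrArg Subtype.val h) x, hφ.isComplexStarAlgebra hθ hψ'⟩
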